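/- Let $A$ be a separable unital C*-algebra. A central sequence in $A$ is a bounded sequence $(a_n)$ in $A$ with $\|a_n b - b a_n\| \to 0$ for every $b \in A$; it is trivial if there are $z_n$ in the center of $A$ with $\|a_n - z_n\| \to 0$. Say that $A$ has continuous trace if every central sequence in $A$ is trivial. Let $\mathrm{Aut}(A)$ be the group of $*$-automorphisms of $A$, with the topology of pointwise norm convergence and its Borel $\sigma$-algebra. Automorphisms $\alpha, \beta$ are unitarily equivalent if $\alpha = \mathrm{Ad}(u) \circ \beta$ for some unitary $u \in A$, where $\mathrm{Ad}(u)(x) = u x u^*$. An equivalence relation $E$ on $X$ is Borel reducible to $F$ on $Y$ if there is a Borel map $f : X \to Y$ such that $f(x_1) \mathrel{F} f(x_2) \iff x_1 \mathrel{E} x_2$ for all $x_1,x_2 \in X$. It is smooth if it is Borel reducible to equality on $\mathbb{R}$, and classifiable by countable structures if, for some countable relational first-order language $\mathcal{L}$, it is Borel reducible to isomorphism of $\mathcal{L}$-structures with universe $\mathbb{N}$, viewed as points of $\prod_{R \in \mathcal{L}} 2^{\mathbb{N}^{n_R}}$, where $n_R$ is the arity of $R$. Theorem. If $A$ does not have continuous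 trace, then the relation of unitary equivalence on $\mathrm{Aut}(A)$ is not classifiable by countable structures. Consequently, for every separable unital C*-algebra $A$, unitary equivalence of automorphisms of $A$ is either smooth or not classifiable by countable structures. -/

import Mathlib

open Filter Topology

namespace NonclassificationUE

/-! ### Borel complexity of equivalence relations -/

/-- `E` is Borel reducible to `F`: there is a Borel function `f` with
`f x₁ F f x₂` if and only if `x₁ E x₂`. -/
def BorelReducible {X Y : Type*} [MeasurableSpace X] [MeasurableSpace Y]
    (E : Setoid X) (F : Setoid Y) : Prop :=
  ∃ f : X → Y, Measurable f ∧ ∀ x₁ x₂ : X, F (f x₁) (f x₂) ↔ E x₁ x₂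

/-- `E` is smooth: it is Borel reducible to the relation of equality of real numbers
(`⊥ : Setoid ℝ` is equality). -/
def IsSmooth {X : Type*} [MeasurableSpace X] (E : Setoid X) : Prop :=
  BorelReducible E (⊥ : Setoid ℝ)

/-- The space `∏_R 2^(ℕ^(n_R))` of structures with universe `ℕ` for a relational language `L`,
where `R` ranges over the relation symbols of `L` and `n_R` is the arity of `R`.
It carries the product σ-algebra, which for countable `L` is the Borel σ-algebra of the product
topology. -/
abbrev StructureSpace (L : FirstOrder.Language.{0, 0}) : Type :=
  (n : ℕ) → L.Relations n → (Fin n → ℕ) → Prop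

/-- The relation of isomorphism of `L`-structures with universe `ℕ`, for a relational `L`. -/
def isoSetoid (L : FirstOrder.Language.{0, 0}) : Setoid (StructureSpace L) where
  r M N := ∃ σ : Equiv.Perm ℕ, ∀ (n : ℕ) (R : L.Relations n) (v : Fin n → ℕ),
    M n R v ↔ N n R (σ ∘ v)
  iseqv :=
    { refl := fun _ => ⟨Equiv.refl ℕ, fun _ _ _ => Iff.rfl⟩
      symm := by
        rintro M N ⟨σ, h⟩
        refine ⟨σ.symm, fun n R v => ?_⟩
        rw [h n R (σ.symm ∘ v), ← Function.comp_assoc, Equiv.self_comp_symm, Function.id_comp]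
      trans := by
        rintro M N P ⟨σ, h⟩ ⟨τ, k⟩
        refine ⟨σ.trans τ, fun n R v => ?_⟩
        rw [h n R v, k n R (σ ∘ v), Equiv.coe_trans, Function.comp_assoc] }

/-- `E` is classifiable by countable structures: it is Borel reducible to the relation of
isomorphism of `L`-structures for some countable relational first-order language `L`. -/
def ClassifiableByCountableStructures {X : Type*} [MeasurableSpace X] (E : Setoid X) : Prop :=
  ∃ L : FirstOrder.Language.{0, 0}, L.IsRelational ∧ Countable L.Symbols ∧
    BorelReducible E (isoSetoid L)

/-! ### Central sequences -/

section CStar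

variable {A : Type*} [CStarAlgebra A]

/-- A central sequence: bounded, and asymptotically commuting with every element. -/
def IsCentralSequence (a : ℕ → A) : Prop :=
  (∃ C : ℝ, ∀ n, ‖a n‖ ≤ C) ∧
    ∀ b : A, Tendsto (fun n => a n * b - b * a n) atTop (𝓝 0)

/-- A sequence that is asymptotically equal in norm to a sequence in the center. -/
def IsTrivialSequence (a : ℕ → A) : Prop :=
  ∃ z : ℕ → A, (∀ n, z n ∈ Subalgebra.center ℂ A) ∧
    Tendsto (fun n => ‖a n - z n‖) atTop (𝓝 0)

variable (A) in
/-- Continuous trace, for separable unital C*-algebras: every central sequence is trivial. -/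
def HasContinuousTrace : Prop :=
  ∀ a : ℕ → A, IsCentralSequence a → IsTrivialSequence a

/-! ### Automorphisms up to unitary equivalence -/

/-- The topology of `Aut(A)`: the weakest one making all point evaluations `α ↦ α x`
continuous, where `A` has the norm topology. -/
instance autTopology : TopologicalSpace (A ≃⋆ₐ[ℂ] A) :=
  TopologicalSpace.induced (fun α : A ≃⋆ₐ[ℂ] A => (α : A → A)) inferInstance

/-- `Aut(A)` carries the Borel σ-algebra of its topology. -/
instance autMeasurableSpace : MeasurableSpace (A ≃⋆ₐ[ℂ] A) := borel _

variable (A) in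
/-- Unitary equivalence of automorphisms: `α = Ad(u) ∘ β` for some unitary `u` of `A`, where
`Ad(u)` is the automorphism `x ↦ u x u*`. -/
def unitaryEquivalence : Setoid (A ≃⋆ₐ[ℂ] A) where
  r α β := ∃ u : unitary A, α = Unitary.conjStarAlgAut ℂ A u * β
  iseqv :=
    { refl := fun α => ⟨1, by rw [map_one, one_mul]⟩
      symm := by
        rintro α β ⟨u, rfl⟩
        exact ⟨u⁻¹, by rw [map_inv, inv_mul_cancel_left]⟩
      trans := by
        rintro α β γ ⟨u, rfl⟩ ⟨v, rfl⟩
        exact ⟨u * v, by rw [map_mul, mul_assoc]⟩ }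

end CStar

end NonclassificationUE

namespace NonclassificationUE

section Category

variable {X Y : Type*} [TopologicalSpace X] [TopologicalSpace Y]

/-- The easy half of the Kuratowski–Ulam theorem: almost every section of a residual set is
residual. -/
theorem eventually_residual_sections [SecondCountableTopology Y] {s : Set (X × Y)}
    (hs : s ∈ residual (X × Y)) :
    ∀ᶠ x in residual X, ∀ᶠ y in residual Y, (x, y) ∈ s := by
  obtain ⟨S, hSo, hSd, hSc, hSs⟩ := mem_residual_iff.1 hs
  have key : ∀ t ∈ S, ∀ᶠ x in residual X, ∀ᶠ y in residual Y, (x, y) ∈ t := by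
    intro t ht
    have h1 : ∀ V ∈ TopologicalSpace.countableBasis Y, ∀ᶠ x in residual X,
        ∃ y ∈ V, (x, y) ∈ t := by
      intro V hV
      have hVo := TopologicalSpace.isOpen_of_mem_countableBasis hV
      have hVn := TopologicalSpace.nonempty_of_mem_countableBasis hV
      refine residual_of_dense_open (s := {x | ∃ y ∈ V, (x, y) ∈ t}) ?_ ?_
      · have : {x | ∃ y ∈ V, (x, y) ∈ t} = Prod.fst '' (t ∩ (Set.univ ×ˢ V)) := by
          ext x; simp [and_comm]
        rw [this]
        exact isOpenMap_fst _ ((hSo t ht).inter (isOpen_univ.prod hVo))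
      · rw [dense_iff_inter_open]
        intro U hU hUn
        obtain ⟨⟨x, y⟩, hxy, hxt⟩ := (hSd t ht).inter_open_nonempty _ (hU.prod hVo) (hUn.prod hVn)
        exact ⟨x, hxy.1, y, hxy.2, hxt⟩
    have h2 := (eventually_countable_ball (TopologicalSpace.countable_countableBasis Y)).2 h1
    filter_upwards [h2] with x hx
    refine residual_of_dense_open (s := {y | (x, y) ∈ t})
      ((hSo t ht).preimage (by fun_prop : Continuous fun y : Y => (x, y))) ?_
    rw [(TopologicalSpace.isBasis_countableBasis Y).dense_iff]
    intro V hV _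
    obtain ⟨y, hyV, hyt⟩ := hx V hV
    exact ⟨y, hyV, hyt⟩
  have h3 := (eventually_countable_ball hSc).2 key
  filter_upwards [h3] with x hx
  filter_upwards [(eventually_countable_ball hSc).2 hx] with y hy
  exact hSs (Set.mem_sInter.2 hy)

/-- The set of points at which `S` is locally non-meagre. -/
def locallyNonmeagre (S : Set X) : Set X := {x | ∀ U, IsOpen U → x ∈ U → ¬ IsMeagre (S ∩ U)}

theorem isClosed_locallyNonmeagre (S : Set X) : IsClosed (locallyNonmeagre S) := by
  rw [← isOpen_compl_iff, isOpen_iff_forall_mem_open]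
  intro x hx
  simp only [locallyNonmeagre, Set.mem_compl_iff, Set.mem_ofPred_eq, not_forall, not_not] at hx
  obtain ⟨U, hU, hxU, hm⟩ := hx
  exact ⟨U, fun y hy h => h U hU hy hm, hU, hxU⟩

theorem locallyNonmeagre_subset_closure (S : Set X) : locallyNonmeagre S ⊆ closure S := by
  intro x hx
  rw [mem_closure_iff]
  intro U hU hxU
  rw [Set.inter_comm]
  exact nonempty_of_not_isMeagre (hx U hU hxU)

theorem isMeagre_diff_locallyNonmeagre [SecondCountableTopology X] (S : Set X) :
    IsMeagre (S \ locallyNonmeagre S) := by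
  let B := {V ∈ TopologicalSpace.countableBasis X | IsMeagre (S ∩ V)}
  have hB : B.Countable := (TopologicalSpace.countable_countableBasis X).mono (Set.sep_subset _ _)
  refine IsMeagre.mono ?_ (isMeagre_biUnion hB (f := fun V => S ∩ V) fun V hV => hV.2)
  rintro x ⟨hxS, hx⟩
  simp only [locallyNonmeagre, Set.mem_ofPred_eq, not_forall, not_not] at hx
  obtain ⟨U, hU, hxU, hm⟩ := hx
  obtain ⟨V, hV, hxV, hVU⟩ :=
    (TopologicalSpace.isBasis_countableBasis X).exists_subset_of_mem_open hxU hU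
  exact Set.mem_biUnion (x := V) ⟨hV, hm.mono (Set.inter_subset_inter_right _ hVU)⟩ ⟨hxS, hxV⟩

theorem isMeagre_locallyNonmeagre_diff_iUnion [SecondCountableTopology X] {ι : Type*} [Countable ι]
    {S : Set X} {T : ι → Set X} (h : S ⊆ ⋃ i, T i) :
    IsMeagre (locallyNonmeagre S \ ⋃ i, locallyNonmeagre (T i)) := by
  set E := locallyNonmeagre S \ ⋃ i, locallyNonmeagre (T i) with hE
  by_contra hne
  have hEB : BaireMeasurableSet E := by
    refine BaireMeasurableSet.diff
      ((isClosed_locallyNonmeagre S).isOpen_compl.baireMeasurableSet.of_compl) ?_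
    exact BaireMeasurableSet.iUnion fun i =>
      (isClosed_locallyNonmeagre (T i)).isOpen_compl.baireMeasurableSet.of_compl
  obtain ⟨W, hW, hEW⟩ := hEB.residualEq_isOpen
  have hEW' := eventuallyEq_set.1 hEW
  have h1 : IsMeagre (E \ W) := by
    filter_upwards [hEW'] with x hx
    simp [hx]
  have h2 : IsMeagre (W \ E) := by
    filter_upwards [hEW'] with x hx
    simp [hx]
  have h3 : (E ∩ W).Nonempty := by
    refine nonempty_of_not_isMeagre fun hm => hne ?_
    rw [← Set.inter_union_sdiff E W]
    exact hm.union h1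
  obtain ⟨x, hxE, hxW⟩ := h3
  refine hxE.1 W hW hxW ?_
  refine IsMeagre.mono ?_
    (h2.union (isMeagre_iUnion fun i => isMeagre_diff_locallyNonmeagre (T i)))
  rintro y ⟨hyS, hyW⟩
  by_cases hyE : y ∈ E
  · obtain ⟨i, hi⟩ := Set.mem_iUnion.1 (h hyS)
    exact Or.inr (Set.mem_iUnion.2 ⟨i, hi, fun hy => hyE.2 (Set.mem_iUnion.2 ⟨i, hy⟩)⟩)
  · exact Or.inl ⟨hyW, hyE⟩

/-- Analytic sets have the property of Baire. -/
theorem baireMeasurableSet_of_analyticSet [T2Space X] [SecondCountableTopology X] {s : Set X}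
    (hs : MeasureTheory.AnalyticSet s) : BaireMeasurableSet s := by
  rw [MeasureTheory.AnalyticSet] at hs
  rcases hs with rfl | ⟨f, hf, rfl⟩
  · exact isOpen_empty.baireMeasurableSet
  let S : List ℕ → Set X := fun l => f '' {a | PiNat.res a l.length = l}
  have hS : ∀ l, S l ⊆ ⋃ i, S (i :: l) := by
    rintro l _ ⟨a, ha, rfl⟩
    refine Set.mem_iUnion.2 ⟨a l.length, a, ?_, rfl⟩
    simp only [Set.mem_ofPred_eq] at ha
    simp [ha]
  let R := ⋃ l, locallyNonmeagre (S l) \ ⋃ i, locallyNonmeagre (S (i :: l))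
  have hR : IsMeagre R := isMeagre_iUnion fun l => isMeagre_locallyNonmeagre_diff_iUnion (hS l)
  have hS0 : S [] = Set.range f := by simp [S, Set.image_univ]
  have hsub : locallyNonmeagre (Set.range f) \ R ⊆ Set.range f := by
    rintro x ⟨hx, hxR⟩
    have hstep : ∀ l, x ∈ locallyNonmeagre (S l) → ∃ i, x ∈ locallyNonmeagre (S (i :: l)) := by
      intro l hl
      by_contra hcon
      exact hxR (Set.mem_iUnion.2 ⟨l, hl, fun h => hcon (Set.mem_iUnion.1 h)⟩)
    choose! nxt hnxt using hstep
    let br : ℕ → List ℕ := fun n => Nat.rec [] (fun _ l => nxt l :: l) n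
    have hbr : ∀ n, x ∈ locallyNonmeagre (S (br n)) := by
      intro n
      induction n with
      | zero =>
        change x ∈ locallyNonmeagre (S [])
        rwa [hS0]
      | succ n ih => exact hnxt _ ih
    have hlen : ∀ n, (br n).length = n := by
      intro n
      induction n with
      | zero => rfl
      | succ n ih => simpa [br] using ih
    let a : ℕ → ℕ := fun n => nxt (br n)
    have hres : ∀ n, PiNat.res a n = br n := by
      intro n
      induction n with
      | zero => rfl
      | succ n ih => rw [PiNat.res_succ, ih]
    refine ⟨a, ?_⟩
    by_contra hne
    obtain ⟨U, V, hU, hV, haU, hxV, hUV⟩ := t2_separation hne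
    have hUn : f ⁻¹' U ∈ 𝓝 a := hf.continuousAt (hU.mem_nhds haU)
    obtain ⟨_, ⟨y, n, rfl⟩, han, hsubU⟩ :=
      (PiNat.isTopologicalBasis_cylinders (fun _ => ℕ)).mem_nhds_iff.1 hUn
    rw [← PiNat.mem_cylinder_iff_eq.1 han] at hsubU
    obtain ⟨z, hzV, b, hb, rfl⟩ :=
      mem_closure_iff.1 (locallyNonmeagre_subset_closure _ (hbr n)) V hV hxV
    refine Set.disjoint_left.1 hUV (hsubU ?_) hzV
    rw [Set.mem_ofPred_eq, hlen, ← hres n] at hb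
    rw [PiNat.cylinder_eq_res]
    exact hb
  have hcl : BaireMeasurableSet (locallyNonmeagre (Set.range f)) :=
    (isClosed_locallyNonmeagre _).isOpen_compl.baireMeasurableSet.of_compl
  refine hcl.congr (eventuallyEq_set.2 ?_)
  have h1 : ∀ᶠ x in residual X, x ∉ R := hR
  have h2 : ∀ᶠ x in residual X, x ∉ Set.range f \ locallyNonmeagre (Set.range f) :=
    isMeagre_diff_locallyNonmeagre _
  filter_upwards [h1, h2] with x hx1 hx2
  exact ⟨fun h => hsub ⟨h, hx1⟩, fun h => by_contra fun h' => hx2 ⟨h, h'⟩⟩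

end Category

section TupleIso

variable {L : FirstOrder.Language.{0, 0}}

/-- `σ` is an isomorphism of `M` onto `N`. -/
def IsStructureIso (M N : StructureSpace L) (σ : Equiv.Perm ℕ) : Prop :=
  ∀ (n : ℕ) (R : L.Relations n) (v : Fin n → ℕ), M n R v ↔ N n R (σ ∘ v)

/-- Some isomorphism of `M` onto `N` maps the tuple `a` to the tuple `b`. -/
def TupleIso (M N : StructureSpace L) (a b : List ℕ) : Prop :=
  ∃ σ : Equiv.Perm ℕ, IsStructureIso M N σ ∧ a.map σ = b

theorem IsStructureIso.symm {M N : StructureSpace L} {σ : Equiv.Perm ℕ}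
    (h : IsStructureIso M N σ) : IsStructureIso N M σ.symm := fun n R v => by
  rw [h n R (σ.symm ∘ v), ← Function.comp_assoc, Equiv.self_comp_symm, Function.id_comp]

theorem IsStructureIso.trans {M N P : StructureSpace L} {σ τ : Equiv.Perm ℕ}
    (h : IsStructureIso M N σ) (k : IsStructureIso N P τ) : IsStructureIso M P (σ.trans τ) :=
  fun n R v => by rw [h n R v, k n R (σ ∘ v), Equiv.coe_trans, Function.comp_assoc]

theorem TupleIso.refl (M : StructureSpace L) (a : List ℕ) : TupleIso M M a a :=
  ⟨Equiv.refl ℕ, fun _ _ _ => Iff.rfl, by simp⟩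

theorem TupleIso.symm {M N : StructureSpace L} {a b : List ℕ} (h : TupleIso M N a b) :
    TupleIso N M b a := by
  obtain ⟨σ, hσ, rfl⟩ := h
  exact ⟨σ.symm, hσ.symm, by simp⟩

theorem TupleIso.trans {M N P : StructureSpace L} {a b c : List ℕ} (h : TupleIso M N a b)
    (k : TupleIso N P b c) : TupleIso M P a c := by
  obtain ⟨σ, hσ, rfl⟩ := h
  obtain ⟨τ, hτ, rfl⟩ := k
  exact ⟨σ.trans τ, hσ.trans hτ, by simp⟩

theorem countable_relations [Countable L.Symbols] (n : ℕ) : Countable (L.Relations n) := by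
  have : Function.Injective fun R : L.Relations n => (Sum.inr ⟨n, R⟩ : L.Symbols) := by
    intro R S h
    simpa using h
  exact this.countable

/-- The existence of an isomorphism respecting given tuples is an analytic condition. -/
theorem analyticSet_tupleIso [Countable L.Symbols] {Z : Type*} [MeasurableSpace Z]
    [StandardBorelSpace Z] [TopologicalSpace Z] [OpensMeasurableSpace Z]
    [SecondCountableTopology Z] {f g : Z → StructureSpace L} (hf : Measurable f)
    (hg : Measurable g) (a b : List ℕ) :
    MeasureTheory.AnalyticSet {z | TupleIso (f z) (g z) a b} := by
  have hcount := countable_relations (L := L)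
  let B : Set ((ℕ → ℕ) × (ℕ → ℕ) × Z) := {p | (∀ n, p.1 (p.2.1 n) = n) ∧
    (∀ n, p.2.1 (p.1 n) = n) ∧ a.map p.1 = b ∧
    ∀ (n : ℕ) (R : L.Relations n) (v : Fin n → ℕ), f p.2.2 n R v ↔ g p.2.2 n R (p.1 ∘ v)}
  have hev : ∀ n : ℕ, Measurable fun p : (ℕ → ℕ) × (ℕ → ℕ) × Z => p.1 n := fun n =>
    (measurable_pi_apply n).comp measurable_fst
  have hev' : ∀ n : ℕ, Measurable fun p : (ℕ → ℕ) × (ℕ → ℕ) × Z => p.2.1 n := fun n =>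
    (measurable_pi_apply n).comp (measurable_fst.comp measurable_snd)
  have hrel : ∀ {h : Z → StructureSpace L}, Measurable h → ∀ (n : ℕ) (R : L.Relations n)
      (v : Fin n → ℕ), MeasurableSet {p : (ℕ → ℕ) × (ℕ → ℕ) × Z | h p.2.2 n R v} := by
    intro h hh n R v
    have h1 : Measurable fun z => h z n R v :=
      (measurable_pi_apply v).comp ((measurable_pi_apply R).comp ((measurable_pi_apply n).comp hh))
    exact measurableSet_setOfPred.2 (h1.comp (measurable_snd.comp measurable_snd))
  have hB : MeasurableSet B := by
    have e : B = (⋂ n, ⋃ k, {p | p.2.1 n = k} ∩ {p | p.1 k = n}) ∩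
        ((⋂ n, ⋃ k, {p | p.1 n = k} ∩ {p | p.2.1 k = n}) ∩ ({p | a.map p.1 = b} ∩
        ⋂ (n : ℕ) (R : L.Relations n) (v : Fin n → ℕ),
          {p | f p.2.2 n R v ↔ g p.2.2 n R (p.1 ∘ v)})) := by
      ext p
      simp [B]
    rw [e]
    refine MeasurableSet.inter ?_ (MeasurableSet.inter ?_ (MeasurableSet.inter ?_ ?_))
    · exact MeasurableSet.iInter fun n => MeasurableSet.iUnion fun k =>
        (measurableSet_eq_fun (hev' n) measurable_const).inter
          (measurableSet_eq_fun (hev k) measurable_const)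
    · exact MeasurableSet.iInter fun n => MeasurableSet.iUnion fun k =>
        (measurableSet_eq_fun (hev n) measurable_const).inter
          (measurableSet_eq_fun (hev' k) measurable_const)
    · clear e
      induction a generalizing b with
      | nil => simp
      | cons c a ih =>
        cases b with
        | nil => simp
        | cons d b =>
          have : {p : (ℕ → ℕ) × (ℕ → ℕ) × Z | (c :: a).map p.1 = d :: b} =
              {p | p.1 c = d} ∩ {p | a.map p.1 = b} := by
            ext p; simp
          rw [this]
          exact (measurableSet_eq_fun (hev c) measurable_const).inter (ih b)
    · refine MeasurableSet.iInter fun n => MeasurableSet.iInter fun R =>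
        MeasurableSet.iInter fun v => ?_
      have e2 : {p : (ℕ → ℕ) × (ℕ → ℕ) × Z | g p.2.2 n R (p.1 ∘ v)} =
          ⋃ w : Fin n → ℕ, (⋂ i, {p | p.1 (v i) = w i}) ∩ {p | g p.2.2 n R w} := by
        ext p
        simp only [Set.mem_ofPred_eq, Set.mem_iUnion, Set.mem_inter_iff, Set.mem_iInter]
        constructor
        · exact fun h => ⟨p.1 ∘ v, fun i => rfl, h⟩
        · rintro ⟨w, hw, h⟩
          have : p.1 ∘ v = w := funext hw
          rwa [this]
      have m2 : MeasurableSet {p : (ℕ → ℕ) × (ℕ → ℕ) × Z | g p.2.2 n R (p.1 ∘ v)} := by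
        rw [e2]
        exact MeasurableSet.iUnion fun w => (MeasurableSet.iInter fun i =>
          measurableSet_eq_fun (hev (v i)) measurable_const).inter (hrel hg n R w)
      exact (hrel hf n R v).iff m2
  have hBa := hB.analyticSet_image (f := fun p : (ℕ → ℕ) × (ℕ → ℕ) × Z => p.2.2)
    (measurable_snd.comp measurable_snd)
  convert hBa using 1
  ext z
  simp only [Set.mem_ofPred_eq, Set.mem_image, B]
  constructor
  · rintro ⟨σ, hσ, hab⟩
    exact ⟨(σ, σ.symm, z), ⟨by simp, by simp, hab, hσ⟩, rfl⟩
  · rintro ⟨⟨s, t, z⟩, ⟨h1, h2, h3, h4⟩, rfl⟩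
    exact ⟨⟨s, t, h2, h1⟩, h4, h3⟩

/-- A nonempty family of finite partial maps closed under back and forth extensions yields an
isomorphism. -/
theorem isoSetoid_of_back_and_forth {M N : StructureSpace L} (S : List (ℕ × ℕ) → Prop)
    (h0 : S []) (hforth : ∀ l, S l → ∀ c, ∃ d, S ((c, d) :: l))
    (hback : ∀ l, S l → ∀ d, ∃ c, S ((c, d) :: l))
    (hinj : ∀ l, S l → ∀ p ∈ l, ∀ q ∈ l, p.1 = q.1 ↔ p.2 = q.2)
    (hrel : ∀ l, S l → ∀ (n : ℕ) (R : L.Relations n) (v w : Fin n → ℕ), (∀ i, (v i, w i) ∈ l) →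
      (M n R v ↔ N n R w)) : isoSetoid L M N := by
  have hstep : ∀ l : {l // S l}, ∀ k : ℕ, ∃ l' : {l // S l},
      l.1 ⊆ l'.1 ∧ (∃ d, (k, d) ∈ l'.1) ∧ ∃ c, (c, k) ∈ l'.1 := by
    rintro ⟨l, hl⟩ k
    obtain ⟨d, hd⟩ := hforth l hl k
    obtain ⟨c, hc⟩ := hback _ hd k
    exact ⟨⟨_, hc⟩, fun x hx => by simp [hx], ⟨d, by simp⟩, ⟨c, by simp⟩⟩
  choose nxt hsub hdom hran using hstep
  let s : ℕ → {l // S l} := fun n => Nat.rec ⟨[], h0⟩ (fun k l => nxt l k) n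
  have hs : ∀ n, s (n + 1) = nxt (s n) n := fun n => rfl
  have hmono : ∀ m n, m ≤ n → (s m).1 ⊆ (s n).1 := by
    intro m n hmn
    induction n, hmn using Nat.le_induction with
    | base => exact fun x hx => hx
    | succ n _ ih => exact fun x hx => hsub _ _ (ih hx)
  have hD : ∀ k, ∃ d, (k, d) ∈ (s (k + 1)).1 := fun k => hdom _ _
  have hC : ∀ k, ∃ c, (c, k) ∈ (s (k + 1)).1 := fun k => hran _ _
  choose F hF using hD
  choose G hG using hC
  have hall : ∀ {i j : ℕ} {p q : ℕ × ℕ}, p ∈ (s i).1 → q ∈ (s j).1 → (p.1 = q.1 ↔ p.2 = q.2) :=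
    fun {i j p q} hp hq => hinj _ (s (max i j)).2 p (hmono _ _ (le_max_left _ _) hp) q
      (hmono _ _ (le_max_right _ _) hq)
  refine ⟨⟨F, G, fun k => ?_, fun k => ?_⟩, fun n R v => ?_⟩
  · exact (hall (i := F k + 1) (j := k + 1) (p := (G (F k), F k)) (q := (k, F k)) (hG (F k)) (hF k)).2 rfl
  · exact (hall (i := G k + 1) (j := k + 1) (p := (G k, F (G k))) (q := (G k, k)) (hF (G k)) (hG k)).1 rfl
  · have hmem : ∀ i, (v i, F (v i)) ∈ (s (Finset.univ.sup v + 1)).1 := fun i =>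
      hmono _ _ (Nat.succ_le_succ (Finset.le_sup (f := v) (Finset.mem_univ i))) (hF (v i))
    exact hrel _ (s (Finset.univ.sup v + 1)).2 n R v _ hmem

end TupleIso

section Ergodicity

open PiNat

/-- The bounded perturbation of a sequence of integers coded by a sequence of natural numbers. -/
def bits (l : ℕ → ℕ) : ℕ → ℤ := fun n => if l n = 0 then 0 else 1

theorem continuous_bits : Continuous bits :=
  continuous_pi fun n =>
    (continuous_of_discreteTopology (f := fun k : ℕ => if k = 0 then (0 : ℤ) else 1)).comp
      (continuous_apply n)

/-- The shear `(x, p) ↦ (x + c p, p)`. -/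
def shear {G P : Type*} [TopologicalSpace G] [AddGroup G] [IsTopologicalAddGroup G]
    [TopologicalSpace P] (c : P → G) (hc : Continuous c) : G × P ≃ₜ G × P where
  toFun q := (q.1 + c q.2, q.2)
  invFun q := (q.1 - c q.2, q.2)
  left_inv q := by simp
  right_inv q := by simp
  continuous_toFun := by fun_prop
  continuous_invFun := by fun_prop

theorem isOpenMap_add_right_comp {G P : Type*} [TopologicalSpace G] [AddGroup G]
    [IsTopologicalAddGroup G] [TopologicalSpace P] (c : P → G) (hc : Continuous c) :
    IsOpenMap fun q : G × P => q.1 + c q.2 :=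
  isOpenMap_fst.comp (shear c hc).isOpenMap

theorem bits_eqOn {l l' : ℕ → ℕ} {N : ℕ} (h : l' ∈ cylinder l N) :
    bits l' ∈ cylinder (bits l) N := fun i hi => by
  simp [bits, h i hi]

theorem sub_mem_cylinder {x x' y y' : ℕ → ℤ} {N : ℕ} (h : x' ∈ cylinder x N)
    (h' : y' ∈ cylinder y N) : x' - y' ∈ cylinder (x - y) N := fun i hi => by
  simp [h i hi, h' i hi]

theorem mem_cylinder_trans {α : Type*} {x y z : ℕ → α} {N : ℕ} (h : x ∈ cylinder y N)
    (h' : y ∈ cylinder z N) : x ∈ cylinder z N := fun i hi => (h i hi).trans (h' i hi)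

theorem exists_cylinder_subset {α : Type*} [TopologicalSpace α] [DiscreteTopology α]
    {U : Set (ℕ → α)} (hU : IsOpen U) {x : ℕ → α} (hx : x ∈ U) : ∃ N, cylinder x N ⊆ U := by
  obtain ⟨_, ⟨y, n, rfl⟩, hxy, hs⟩ :=
    (isTopologicalBasis_cylinders (fun _ => α)).exists_subset_of_mem_open hx hU
  exact ⟨n, by rwa [← mem_cylinder_iff_eq.1 hxy] at hs⟩

/-- The result of moving `y` by the difference of two coded perturbations. -/
def move (y : ℕ → ℤ) (p : (ℕ → ℕ) × (ℕ → ℕ)) : ℕ → ℤ := y + (bits p.2 - bits p.1)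

theorem continuous_bits_sub :
    Continuous fun p : (ℕ → ℕ) × (ℕ → ℕ) => bits p.2 - bits p.1 :=
  (continuous_bits.comp continuous_snd).sub (continuous_bits.comp continuous_fst)

/-- Every residual property of points and moves holds for generic moves from the points of some
residual set which is stable under generic moves. -/
theorem exists_residual_move_stable {T : Set ((ℕ → ℤ) × (ℕ → ℕ) × (ℕ → ℕ))} (hT : T ∈ residual _)
    {C₀ : Set (ℕ → ℤ)} (hC₀ : C₀ ∈ residual _) :
    ∃ C ∈ residual (ℕ → ℤ), C ⊆ C₀ ∧
      ∀ y ∈ C, ∀ᶠ p in residual _, (y, p) ∈ T ∧ move y p ∈ C := by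
  have hmove : Tendsto (fun q : (ℕ → ℤ) × (ℕ → ℕ) × (ℕ → ℕ) => move q.1 q.2) (residual _)
      (residual _) :=
    tendsto_residual_of_isOpenMap
      (continuous_fst.add (continuous_bits_sub.comp continuous_snd))
      (isOpenMap_add_right_comp _ continuous_bits_sub)
  let D : ℕ → Set (ℕ → ℤ) := fun n =>
    Nat.rec C₀ (fun _ E => {y | ∀ᶠ p in residual _, (y, p) ∈ T ∧ move y p ∈ E}) n
  have hD : ∀ n, D n ∈ residual (ℕ → ℤ) := by
    intro n
    induction n with
    | zero => exact hC₀
    | succ n ih => exact eventually_residual_sections (inter_mem hT (hmove ih))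
  refine ⟨⋂ n, D n, countable_iInter_mem.2 hD, Set.iInter_subset _ 0, fun y hy => ?_⟩
  have h1 : ∀ n, ∀ᶠ p in residual _, (y, p) ∈ T ∧ move y p ∈ D n := fun n =>
    Set.mem_iInter.1 hy (n + 1)
  filter_upwards [eventually_countable_forall.2 h1] with p hp
  exact ⟨(hp 0).1, Set.mem_iInter.2 fun n => (hp n).2⟩

/-- Finitely many moves that keep the first `N` coordinates lead from any point of a stable set
into any smaller cylinder. -/
theorem exists_chain_of_moves {C : Set (ℕ → ℤ)} {P : (ℕ → ℤ) → (ℕ → ℤ) → Prop}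
    (hrefl : ∀ y, P y y) (htrans : ∀ x y z, P x y → P y z → P x z) {z : ℕ → ℤ} {l₀ : ℕ → ℕ} {N : ℕ}
    (hstep : ∀ y ∈ C, y ∈ cylinder z N → ∀ᶠ p in residual ((ℕ → ℕ) × (ℕ → ℕ)),
      p.1 ∈ cylinder l₀ N → p.2 ∈ cylinder l₀ N → P y (move y p) ∧ move y p ∈ C)
    {w : ℕ → ℤ} (hw : w ∈ cylinder z N) {m : ℕ} {y : ℕ → ℤ} (hyC : y ∈ C)
    (hyz : y ∈ cylinder z N) : ∃ y' ∈ C, y' ∈ cylinder w m ∧ y' ∈ cylinder z N ∧ P y y' := by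
  obtain ⟨d, hd⟩ : ∃ d, d = ∑ i ∈ Finset.range m, (y i - w i).natAbs := ⟨_, rfl⟩
  induction d generalizing y with
  | zero =>
    refine ⟨y, hyC, fun i hi => ?_, hyz, hrefl y⟩
    exact sub_eq_zero.1 (Int.natAbs_eq_zero.1
      (Finset.sum_eq_zero_iff.1 hd.symm i (Finset.mem_range.2 hi)))
  | succ d ih =>
    have : ∃ i ∈ Finset.range m, (y i - w i).natAbs ≠ 0 := by
      by_contra! hcon
      rw [Finset.sum_eq_zero hcon] at hd
      omega
    obtain ⟨i, hi, hne⟩ := this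
    have hiN : N ≤ i := by
      by_contra! hlt
      apply hne
      rw [hyz i hlt, hw i hlt]
      simp
    let base : ℕ → ℕ := fun j => if j < N then l₀ j else 0
    let q : (ℕ → ℕ) × (ℕ → ℕ) := if w i < y i then (Function.update base i 1, base) else
      (base, Function.update base i 1)
    let K := max N (max m (i + 1))
    have hopen : IsOpen (cylinder q.1 K ×ˢ cylinder q.2 K) :=
      (isOpen_cylinder _ _ _).prod (isOpen_cylinder _ _ _)
    obtain ⟨p, hpK, hp⟩ := (dense_of_mem_residual (hstep y hyC hyz)).inter_open_nonempty _ hopen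
      ⟨q, self_mem_cylinder _ _, self_mem_cylinder _ _⟩
    have hbase : base ∈ cylinder l₀ N := fun j hj => by simp [base, hj]
    have hupd : Function.update base i 1 ∈ cylinder l₀ N := fun j hj => by
      rw [Function.update_of_ne (by omega)]
      exact hbase j hj
    have hq1 : q.1 ∈ cylinder l₀ N := by
      simp only [q]; split_ifs <;> assumption
    have hq2 : q.2 ∈ cylinder l₀ N := by
      simp only [q]; split_ifs <;> assumption
    obtain ⟨hP, hC⟩ := hp (mem_cylinder_trans (cylinder_anti _ (le_max_left _ _) hpK.1) hq1)
      (mem_cylinder_trans (cylinder_anti _ (le_max_left _ _) hpK.2) hq2)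
    have hval : ∀ j < K, move y p j = if j = i then (if w i < y i then y i - 1 else y i + 1)
        else y j := by
      intro j hj
      have h1 : p.1 j = q.1 j := hpK.1 j hj
      have h2 : p.2 j = q.2 j := hpK.2 j hj
      have hbi : base i = 0 := by simp [base, hiN]
      simp only [move, Pi.add_apply, Pi.sub_apply, bits, h1, h2]
      by_cases hlt : w i < y i
      · have hq : q = (Function.update base i 1, base) := if_pos hlt
        rw [hq, if_pos hlt]
        rcases eq_or_ne j i with rfl | hji
        · simp [hbi, sub_eq_add_neg]
        · simp [hji]
      · have hq : q = (base, Function.update base i 1) := if_neg hlt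
        rw [hq, if_neg hlt]
        rcases eq_or_ne j i with rfl | hji
        · simp [hbi]
        · simp [hji]
    have hz' : move y p ∈ cylinder z N := by
      intro j hj
      rw [hval j (lt_of_lt_of_le hj (le_max_left _ _)), if_neg (by omega)]
      exact hyz j hj
    obtain ⟨y', h1, h2, h3, h4⟩ := ih hC hz' (by
      have hi' : i < m := Finset.mem_range.1 hi
      rw [← Finset.add_sum_erase _ _ hi] at hd ⊢
      have hsum : ∑ j ∈ (Finset.range m).erase i, (move y p j - w j).natAbs =
          ∑ j ∈ (Finset.range m).erase i, (y j - w j).natAbs := by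
        refine Finset.sum_congr rfl fun j hj => ?_
        have hjm : j < m := Finset.mem_range.1 (Finset.mem_of_mem_erase hj)
        rw [hval j (by omega), if_neg (Finset.ne_of_mem_erase hj)]
      rw [hsum, hval i (by omega), if_pos rfl]
      split_ifs <;> omega)
    exact ⟨y', h1, h2, h3, htrans _ _ _ hP h4⟩

variable {L : FirstOrder.Language.{0, 0}}

/-- Up to a residual set, whether `h` satisfies a given atomic formula is an open condition. -/
theorem exists_residual_locally_decided [Countable L.Symbols] {h : (ℕ → ℤ) → StructureSpace L}
    (hh : Measurable h) :
    ∃ C ∈ residual (ℕ → ℤ), ∀ y ∈ C, ∀ (n : ℕ) (R : L.Relations n) (v : Fin n → ℕ),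
      ∃ N, ∀ y' ∈ C, y' ∈ cylinder y N → (h y n R v ↔ h y' n R v) := by
  have hcount := countable_relations (L := L)
  have hm : ∀ (n : ℕ) (R : L.Relations n) (v : Fin n → ℕ), MeasurableSet {y | h y n R v} :=
    fun n R v => measurableSet_setOfPred.2 ((measurable_pi_apply v).comp
      ((measurable_pi_apply R).comp ((measurable_pi_apply n).comp hh)))
  have h1 : ∀ (n : ℕ) (R : L.Relations n) (v : Fin n → ℕ), ∃ u : Set (ℕ → ℤ), IsOpen u ∧
      ∀ᶠ y in residual _, (h y n R v ↔ y ∈ u) := fun n R v => by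
    obtain ⟨u, hu, he⟩ := (hm n R v).residualEq_isOpen
    exact ⟨u, hu, eventuallyEq_set.1 he⟩
  have h2 : ∀ (n : ℕ) (R : L.Relations n) (v : Fin n → ℕ), ∃ u : Set (ℕ → ℤ), IsOpen u ∧
      ∀ᶠ y in residual _, (¬ h y n R v ↔ y ∈ u) := fun n R v => by
    obtain ⟨u, hu, he⟩ := (hm n R v).compl.residualEq_isOpen
    exact ⟨u, hu, eventuallyEq_set.1 he⟩
  choose u hu heu using h1
  choose u' hu' heu' using h2
  refine ⟨{y | ∀ (n : ℕ) (R : L.Relations n) (v : Fin n → ℕ),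
    (h y n R v ↔ y ∈ u n R v) ∧ (¬ h y n R v ↔ y ∈ u' n R v)}, ?_, ?_⟩
  · refine eventually_countable_forall.2 fun n => eventually_countable_forall.2 fun R =>
      eventually_countable_forall.2 fun v => (heu n R v).and (heu' n R v)
  · intro y hy n R v
    by_cases hyR : h y n R v
    · obtain ⟨N, hN⟩ := exists_cylinder_subset (hu n R v) ((hy n R v).1.1 hyR)
      exact ⟨N, fun y' hy' hc => iff_of_true hyR ((hy' n R v).1.2 (hN hc))⟩
    · obtain ⟨N, hN⟩ := exists_cylinder_subset (hu' n R v) ((hy n R v).2.1 hyR)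
      exact ⟨N, fun y' hy' hc => iff_of_false hyR ((hy' n R v).2.2 (hN hc))⟩

/-- Around a generic point, generic small moves preserve the isomorphism type of the
structure expanded by the tuple `b`. -/
theorem exists_residual_locally_constant [Countable L.Symbols]
    {h : (ℕ → ℤ) → StructureSpace L} (hh : Measurable h)
    (hinv : ∀ (l : ℕ → ℕ) (x : ℕ → ℤ), isoSetoid L (h (x + bits l)) (h x)) (b : List ℕ) :
    ∃ T ∈ residual ((ℕ → ℤ) × (ℕ → ℕ) × (ℕ → ℕ)), ∃ C ∈ residual (ℕ → ℤ), ∀ y ∈ C,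
      ∃ (N : ℕ) (l₀ : ℕ → ℕ), ∀ y' ∈ cylinder y N, ∀ p : (ℕ → ℕ) × (ℕ → ℕ),
        p.1 ∈ cylinder l₀ N → p.2 ∈ cylinder l₀ N → (y', p) ∈ T →
          TupleIso (h y') (h (move y' p)) b b := by
  let Q : List ℕ → Set ((ℕ → ℤ) × (ℕ → ℕ)) := fun b' =>
    {q | TupleIso (h (q.1 + bits q.2)) (h q.1) b b'}
  have hadd : Continuous fun q : (ℕ → ℤ) × (ℕ → ℕ) => q.1 + bits q.2 :=
    continuous_fst.add (continuous_bits.comp continuous_snd)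
  have hQ : ∀ b', ∃ W, IsOpen W ∧ ∀ᶠ q in residual _, (q ∈ Q b' ↔ q ∈ W) := by
    intro b'
    have hA : MeasureTheory.AnalyticSet (Q b') :=
      analyticSet_tupleIso (hh.comp hadd.measurable) (hh.comp measurable_fst) b b'
    obtain ⟨W, hW, he⟩ := (baireMeasurableSet_of_analyticSet hA).residualEq_isOpen
    exact ⟨W, hW, eventuallyEq_set.1 he⟩
  choose W hW hQW using hQ
  let T₀ := {q | ∀ b', q ∈ Q b' ↔ q ∈ W b'}
  have hT₀ : T₀ ∈ residual _ := eventually_countable_forall.2 hQW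
  have hcover : ∀ q ∈ T₀, ∃ b', q ∈ W b' := by
    intro q hq
    obtain ⟨σ, hσ⟩ := hinv q.2 q.1
    exact ⟨b.map σ, (hq _).1 ⟨σ, hσ, rfl⟩⟩
  have hsub1 : Tendsto (fun q : (ℕ → ℤ) × (ℕ → ℕ) × (ℕ → ℕ) => (q.1 - bits q.2.1, q.2.1))
      (residual _) (residual _) := by
    have hc : Continuous fun p : (ℕ → ℕ) × (ℕ → ℕ) => - bits p.1 :=
      (continuous_bits.comp continuous_fst).neg
    have e : (fun q : (ℕ → ℤ) × (ℕ → ℕ) × (ℕ → ℕ) => (q.1 - bits q.2.1, q.2.1)) =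
        Prod.map id Prod.fst ∘ shear _ hc := by
      funext q; simp [shear, sub_eq_add_neg]
    rw [e]
    exact tendsto_residual_of_isOpenMap
      ((continuous_id.prodMap continuous_fst).comp (shear _ hc).continuous)
      ((IsOpenMap.id.prodMap isOpenMap_fst).comp (shear _ hc).isOpenMap)
  have hsub2 : Tendsto (fun q : (ℕ → ℤ) × (ℕ → ℕ) × (ℕ → ℕ) => (q.1 - bits q.2.1, q.2.2))
      (residual _) (residual _) := by
    have hc : Continuous fun p : (ℕ → ℕ) × (ℕ → ℕ) => - bits p.1 :=
      (continuous_bits.comp continuous_fst).neg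
    have e : (fun q : (ℕ → ℤ) × (ℕ → ℕ) × (ℕ → ℕ) => (q.1 - bits q.2.1, q.2.2)) =
        Prod.map id Prod.snd ∘ shear _ hc := by
      funext q; simp [shear, sub_eq_add_neg]
    rw [e]
    exact tendsto_residual_of_isOpenMap
      ((continuous_id.prodMap continuous_snd).comp (shear _ hc).continuous)
      ((IsOpenMap.id.prodMap isOpenMap_snd).comp (shear _ hc).isOpenMap)
  let O := (fun q : (ℕ → ℤ) × (ℕ → ℕ) => q.1 + bits q.2) '' ⋃ b', W b'
  refine ⟨_, inter_mem (hsub1 hT₀) (hsub2 hT₀), O, residual_of_dense_open ?_ ?_, ?_⟩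
  · exact isOpenMap_add_right_comp _ continuous_bits _ (isOpen_iUnion hW)
  · rw [dense_iff_inter_open]
    rintro U hU ⟨x, hx⟩
    obtain ⟨q, hqU, hq⟩ := (dense_of_mem_residual hT₀).inter_open_nonempty _ (hU.preimage hadd)
      ⟨(x - bits 0, 0), by simpa using hx⟩
    exact ⟨_, hqU, q, Set.mem_iUnion.2 (hcover q hq), rfl⟩
  · rintro _ ⟨⟨x₀, l₀⟩, hq, rfl⟩
    obtain ⟨b', hb'⟩ := Set.mem_iUnion.1 hq
    obtain ⟨U, V, hU, hV, hxU, hlV, hUV⟩ := isOpen_prod_iff.1 (hW b') x₀ l₀ hb'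
    obtain ⟨N₁, hN₁⟩ := exists_cylinder_subset hU hxU
    obtain ⟨N₂, hN₂⟩ := exists_cylinder_subset hV hlV
    refine ⟨max N₁ N₂, l₀, fun y' hy' p hp1 hp2 hT => ?_⟩
    have hx : y' - bits p.1 ∈ U := by
      refine hN₁ (cylinder_anti x₀ (le_max_left N₁ N₂) ?_)
      simpa using sub_mem_cylinder hy' (bits_eqOn hp1)
    have hl : ∀ {l}, l ∈ cylinder l₀ (max N₁ N₂) → l ∈ V := fun hl =>
      hN₂ (cylinder_anti _ (le_max_right _ _) hl)
    have i1 : TupleIso (h (y' - bits p.1 + bits p.1)) (h (y' - bits p.1)) b b' :=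
      (hT.1 b').2 (hUV ⟨hx, hl hp1⟩)
    have i2 : TupleIso (h (y' - bits p.1 + bits p.2)) (h (y' - bits p.1)) b b' :=
      (hT.2 b').2 (hUV ⟨hx, hl hp2⟩)
    rw [sub_add_cancel] at i1
    have e : move y' p = y' - bits p.1 + bits p.2 := by simp only [move]; abel
    rw [e]
    exact i1.trans i2.symm

/-- Generic ergodicity of bounded perturbations of sequences of integers with respect to
isomorphism of countable structures. -/
theorem exists_residual_isoSetoid [Countable L.Symbols]
    {h : (ℕ → ℤ) → StructureSpace L} (hh : Measurable h)
    (hinv : ∀ (l : ℕ → ℕ) (x : ℕ → ℤ), isoSetoid L (h (x + bits l)) (h x)) :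
    ∃ C ∈ residual (ℕ → ℤ), ∀ x ∈ C, ∀ y ∈ C, isoSetoid L (h x) (h y) := by
  choose T hT C₁ hC₁ hloc using fun b => exists_residual_locally_constant hh hinv b
  obtain ⟨C₂, hC₂, hdec⟩ := exists_residual_locally_decided hh
  obtain ⟨C, hC, hCsub, hstable⟩ := exists_residual_move_stable
    (countable_iInter_mem.2 hT) (inter_mem (countable_iInter_mem.2 hC₁) hC₂)
  have hmv : ∀ (b : List ℕ) (z : ℕ → ℤ) (N : ℕ) (l₀ : ℕ → ℕ),
      (∀ y' ∈ cylinder z N, ∀ p : (ℕ → ℕ) × (ℕ → ℕ),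
        p.1 ∈ cylinder l₀ N → p.2 ∈ cylinder l₀ N → (y', p) ∈ T b →
          TupleIso (h y') (h (move y' p)) b b) →
      ∀ w ∈ cylinder z N, ∀ m, ∀ y ∈ C, y ∈ cylinder z N →
        ∃ y' ∈ C, y' ∈ cylinder w m ∧ y' ∈ cylinder z N ∧ TupleIso (h y) (h y') b b := by
    intro b z N l₀ hgood w hw m y hy hyz
    refine exists_chain_of_moves (P := fun y y' => TupleIso (h y) (h y') b b)
      (fun y => .refl _ _) (fun _ _ _ h1 h2 => h1.trans h2) (l₀ := l₀) ?_ hw hy hyz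
    intro y hy hyz
    filter_upwards [hstable y hy] with p hp h1 h2
    exact ⟨hgood y hyz p h1 h2 (Set.mem_iInter.1 hp.1 b), hp.2⟩
  refine ⟨C, hC, fun x₁ hx₁ x₂ hx₂ => ?_⟩
  let S : ((ℕ → ℤ) × (ℕ → ℤ)) → List (ℕ × ℕ) → Prop := fun x l =>
    ∃ y₁ ∈ C, ∃ y₂ ∈ C, ∃ σ τ : Equiv.Perm ℕ, IsStructureIso (h x.1) (h y₁) σ ∧
      IsStructureIso (h x.2) (h y₂) τ ∧ (∀ p ∈ l, σ p.1 = τ p.2) ∧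
      ∃ (z : ℕ → ℤ) (N : ℕ) (l₀ : ℕ → ℕ), y₁ ∈ cylinder z N ∧ y₂ ∈ cylinder z N ∧
        (∀ y' ∈ cylinder z N, ∀ p : (ℕ → ℕ) × (ℕ → ℕ),
          p.1 ∈ cylinder l₀ N → p.2 ∈ cylinder l₀ N → (y', p) ∈ T (l.map fun p => σ p.1) →
            TupleIso (h y') (h (move y' p)) (l.map fun p => σ p.1) (l.map fun p => σ p.1))
  have hsymm : ∀ x l, S x l → S x.swap (l.map Prod.swap) := by
    rintro x l ⟨y₁, hy₁, y₂, hy₂, σ, τ, hσ, hτ, hl, z, N, l₀, hz1, hz2, hg⟩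
    refine ⟨y₂, hy₂, y₁, hy₁, τ, σ, hτ, hσ, ?_, z, N, l₀, hz2, hz1, ?_⟩
    · intro p hp
      obtain ⟨q, hq, rfl⟩ := List.mem_map.1 hp
      exact (hl q hq).symm
    · have e : (l.map Prod.swap).map (fun p => τ p.1) = l.map fun p => σ p.1 := by
        rw [List.map_map]
        exact List.map_congr_left fun p hp => (hl p hp).symm
      rw [e]
      exact hg
  have hforth : ∀ x l, S x l → ∀ c, ∃ d, S x ((c, d) :: l) := by
    rintro x l ⟨y₁, hy₁, y₂, hy₂, σ, τ, hσ, hτ, hl, z, N, l₀, hz1, hz2, hg⟩ c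
    obtain ⟨N', l₀', hg'⟩ := hloc (σ c :: l.map fun p => σ p.1) y₁
      (Set.mem_iInter.1 (hCsub hy₁).1 _)
    obtain ⟨y₂', hy₂', hc, -, ρ, hρ, hρl⟩ := hmv _ z N l₀ hg y₁ hz1 N' y₂ hy₂ hz2
    refine ⟨τ.symm (ρ.symm (σ c)), y₁, hy₁, y₂', hy₂', σ, τ.trans ρ, hσ, hτ.trans hρ, ?_,
      y₁, N', l₀', self_mem_cylinder _ _, hc, hg'⟩
    intro p hp
    rcases List.mem_cons.1 hp with rfl | hp
    · simp
    · have : ρ (σ p.1) = σ p.1 := by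
        rw [List.map_map] at hρl
        exact List.map_inj_left.1 hρl p hp
      rw [Equiv.trans_apply, ← hl p hp, this]
  refine isoSetoid_of_back_and_forth (S (x₁, x₂)) ?_ (hforth _) ?_ ?_ ?_
  · refine ⟨x₁, hx₁, x₂, hx₂, Equiv.refl ℕ, Equiv.refl ℕ, fun _ _ _ => Iff.rfl,
      fun _ _ _ => Iff.rfl, by simp, x₁, 0, 0, by simp, by simp, fun y' _ p _ _ _ => ?_⟩
    have e : move y' p = y' - bits p.1 + bits p.2 := by simp only [move]; abel
    obtain ⟨σ, hσ⟩ := hinv p.1 (y' - bits p.1)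
    obtain ⟨τ, hτ⟩ := hinv p.2 (y' - bits p.1)
    rw [sub_add_cancel] at hσ
    rw [← e] at hτ
    exact ⟨_, IsStructureIso.trans hσ (IsStructureIso.symm hτ), rfl⟩
  · intro l hl d
    obtain ⟨c, hc⟩ := hforth _ _ (hsymm _ _ hl) d
    refine ⟨c, ?_⟩
    have := hsymm _ _ hc
    simpa using this
  · rintro l ⟨y₁, hy₁, y₂, hy₂, σ, τ, hσ, hτ, hl, -⟩ p hp q hq
    rw [← σ.apply_eq_iff_eq, hl p hp, hl q hq, τ.apply_eq_iff_eq]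
  · rintro l ⟨y₁, hy₁, y₂, hy₂, σ, τ, hσ, hτ, hl, z, N, l₀, hz1, hz2, hg⟩ n R v w hvw
    obtain ⟨N', hN'⟩ := hdec y₁ (hCsub hy₁).2 n R (σ ∘ v)
    obtain ⟨y₂', hy₂', hc, -, ρ, hρ, hρl⟩ := hmv _ z N l₀ hg y₁ hz1 N' y₂ hy₂ hz2
    have e1 : σ ∘ v = τ ∘ w := funext fun i => hl _ (hvw i)
    have e2 : ρ ∘ (τ ∘ w) = σ ∘ v := by
      rw [← e1]
      rw [List.map_map] at hρl
      exact funext fun i => List.map_inj_left.1 hρl _ (hvw i)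
    rw [hσ n R v, hτ n R w, hρ n R (τ ∘ w), e2]
    exact hN' y₂' (hCsub hy₂').2 hc

end Ergodicity

section CentralUnitaries

variable {A : Type*} [CStarAlgebra A]

theorem IsCentralSequence.star {a : ℕ → A} (h : IsCentralSequence a) :
    IsCentralSequence fun n => star (a n) := by
  obtain ⟨⟨C, hC⟩, h⟩ := h
  refine ⟨⟨C, fun n => by simpa using hC n⟩, fun b => ?_⟩
  have := ((h (Star.star b)).star).neg
  simpa using this

theorem IsCentralSequence.add {a b : ℕ → A} (ha : IsCentralSequence a)
    (hb : IsCentralSequence b) : IsCentralSequence fun n => a n + b n := by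
  obtain ⟨⟨C, hC⟩, ha⟩ := ha
  obtain ⟨⟨D, hD⟩, hb⟩ := hb
  refine ⟨⟨C + D, fun n => (norm_add_le _ _).trans (add_le_add (hC n) (hD n))⟩, fun c => ?_⟩
  have := (ha c).add (hb c)
  rw [add_zero] at this
  refine this.congr fun n => ?_
  noncomm_ring

theorem IsCentralSequence.smul {a : ℕ → A} (ha : IsCentralSequence a) (c : ℂ) :
    IsCentralSequence fun n => c • a n := by
  obtain ⟨⟨C, hC⟩, ha⟩ := ha
  refine ⟨⟨‖c‖ * C, fun n => ?_⟩, fun b => ?_⟩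
  · rw [norm_smul]
    exact mul_le_mul_of_nonneg_left (hC n) (norm_nonneg c)
  · have := (ha b).const_smul c
    rw [smul_zero] at this
    refine this.congr fun n => ?_
    rw [smul_mul_assoc, mul_smul_comm, smul_sub]

theorem IsTrivialSequence.add {a b : ℕ → A} (ha : IsTrivialSequence a)
    (hb : IsTrivialSequence b) : IsTrivialSequence fun n => a n + b n := by
  obtain ⟨z, hz, hza⟩ := ha
  obtain ⟨w, hw, hwb⟩ := hb
  refine ⟨fun n => z n + w n, fun n => add_mem (hz n) (hw n), ?_⟩
  have h0 := hza.add hwb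
  rw [add_zero] at h0
  refine squeeze_zero (fun n => norm_nonneg _) (fun n => ?_) h0
  rw [add_sub_add_comm]
  exact norm_add_le _ _

theorem IsTrivialSequence.smul {a : ℕ → A} (ha : IsTrivialSequence a) (c : ℂ) :
    IsTrivialSequence fun n => c • a n := by
  obtain ⟨z, hz, hza⟩ := ha
  refine ⟨fun n => c • z n, fun n => (Subalgebra.center ℂ A).smul_mem (hz n) c, ?_⟩
  have := hza.const_mul ‖c‖
  rw [mul_zero] at this
  refine this.congr fun n => ?_
  rw [← smul_sub, norm_smul]

/-- Nontrivial central sequences can be chosen self-adjoint. -/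
theorem exists_selfAdjoint_centralSequence (h : ¬ HasContinuousTrace A) :
    ∃ a : ℕ → A, (∀ n, IsSelfAdjoint (a n)) ∧ IsCentralSequence a ∧ ¬ IsTrivialSequence a := by
  by_contra! hcon
  refine h fun a ha => ?_
  have h1 := hcon (fun n => a n + star (a n)) (fun n => IsSelfAdjoint.add_star_self _)
    (ha.add ha.star)
  have h2 := hcon (fun n => Complex.I • a n + star (Complex.I • a n))
    (fun n => IsSelfAdjoint.add_star_self _) ((ha.smul _).add (ha.smul _).star)
  have h3 := (h1.smul (1 / 2)).add (h2.smul (- Complex.I / 2))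
  convert h3 using 2 with n
  simp only [star_smul, Complex.star_def, Complex.conj_I, smul_add, smul_smul]
  have e : (-Complex.I / 2 * Complex.I : ℂ) = 1 / 2 := by
    rw [div_mul_eq_mul_div, neg_mul, Complex.I_mul_I, neg_neg]
  rw [mul_neg, e, neg_smul]
  have : a n = (1 / 2 : ℂ) • a n + (1 / 2 : ℂ) • a n := by rw [← add_smul]; norm_num
  nth_rewrite 1 [this]
  abel

/-- A nontrivial sequence is frequently at a fixed positive distance from the center. -/
theorem exists_frequently_far_from_center {a : ℕ → A} (h : ¬ IsTrivialSequence a) :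
    ∃ δ > 0, ∃ᶠ n in atTop, ∀ z ∈ Subalgebra.center ℂ A, δ ≤ ‖a n - z‖ := by
  by_contra! hcon
  apply h
  have hne : (Subalgebra.center ℂ A : Set A).Nonempty := ⟨0, zero_mem _⟩
  have hz : ∀ n, ∃ z ∈ (Subalgebra.center ℂ A : Set A),
      dist (a n) z < Metric.infDist (a n) (Subalgebra.center ℂ A : Set A) + 1 / ((n : ℝ) + 1) :=
    fun n => (Metric.infDist_lt_iff hne).1 (lt_add_of_pos_right _ (by positivity))
  choose z hz hza using hz
  refine ⟨z, hz, ?_⟩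
  have hinf : Tendsto (fun n => Metric.infDist (a n) (Subalgebra.center ℂ A : Set A)) atTop
      (𝓝 0) := by
    rw [Metric.tendsto_atTop']
    intro ε hε
    have := hcon ε hε
    rw [eventually_atTop] at this
    obtain ⟨N, hN⟩ := this
    refine ⟨N, fun n hn => ?_⟩
    have := hN n hn.le
    obtain ⟨w, hw, hlt⟩ := this
    rw [Real.dist_eq, sub_zero, abs_of_nonneg Metric.infDist_nonneg]
    rw [← dist_eq_norm] at hlt
    exact (Metric.infDist_le_dist_of_mem hw).trans_lt hlt
  have h0 := hinf.add tendsto_one_div_add_atTop_nhds_zero_nat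
  rw [add_zero] at h0
  refine squeeze_zero (fun n => norm_nonneg _) (fun n => ?_) h0
  rw [← dist_eq_norm]
  exact (hza n).le

theorem exists_norm_exp_sub_one_sub_le {c : ℝ} (hc : 0 < c) :
    ∃ r > 0, ∀ b : A, ‖b‖ ≤ r → ‖NormedSpace.exp b - 1 - b‖ ≤ c * ‖b‖ := by
  have h := (hasFDerivAt_exp_zero (𝕂 := ℂ) (𝔸 := A)).isLittleO.def hc
  obtain ⟨r, hr, hball⟩ := Metric.eventually_nhds_iff.1 h
  refine ⟨r / 2, by positivity, fun b hb => ?_⟩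
  have := hball (y := b) (by rw [dist_zero_right]; linarith)
  simpa [NormedSpace.exp_zero] using this

theorem norm_commutator_pow_le (v : unitary A) (x : A) (j : ℕ) :
    ‖((v ^ j : unitary A) : A) * x - x * ((v ^ j : unitary A) : A)‖ ≤
      j * ‖(v : A) * x - x * (v : A)‖ := by
  induction j with
  | zero => simp
  | succ j ih =>
    have e : ((v ^ (j + 1) : unitary A) : A) * x - x * ((v ^ (j + 1) : unitary A) : A) =
        (v : A) * (((v ^ j : unitary A) : A) * x - x * ((v ^ j : unitary A) : A)) +
          ((v : A) * x - x * (v : A)) * ((v ^ j : unitary A) : A) := by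
      rw [pow_succ']
      simp only [Submonoid.coe_mul]
      noncomm_ring
    rw [e]
    refine (norm_add_le _ _).trans ?_
    rw [CStarRing.norm_coe_unitary_mul, CStarRing.norm_mul_coe_unitary]
    rw [Nat.cast_succ, add_mul, one_mul]
    linarith

/-- If there is a nontrivial central sequence, then there are unitaries close to `1` whose powers
are asymptotically central up to a power far from the center. -/
theorem exists_unitary_powers (h : ¬ HasContinuousTrace A) :
    ∃ δ > 0, ∀ (F : Set A), F.Finite → ∀ ε > 0, ∃ (v : unitary A) (m : ℕ),
      ‖(v : A) - 1‖ ≤ ε ∧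
      (∀ j ≤ m, ∀ x ∈ F, ‖((v ^ j : unitary A) : A) * x - x * ((v ^ j : unitary A) : A)‖ ≤ ε) ∧
      ∀ z ∈ Subalgebra.center ℂ A, δ ≤ ‖((v ^ m : unitary A) : A) - z‖ := by
  obtain ⟨a, hsa, ⟨⟨M', hM'⟩, hc⟩, hnt⟩ := exists_selfAdjoint_centralSequence h
  obtain ⟨δ, hδ, hfreq⟩ := exists_frequently_far_from_center hnt
  obtain ⟨M, hM0, hM⟩ : ∃ M > 0, ∀ n, ‖a n‖ ≤ M :=
    ⟨max M' 1, by positivity, fun n => (hM' n).trans (le_max_left _ _)⟩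
  obtain ⟨s, hs, hexp⟩ := exists_norm_exp_sub_one_sub_le (A := A) (c := δ / (2 * M)) (by positivity)
  refine ⟨s / M * δ / 2, by positivity, fun F hF ε hε => ?_⟩
  obtain ⟨K, hK0, hK⟩ : ∃ K > 0, ∀ x ∈ F, ‖x‖ ≤ K := by
    obtain ⟨K, hK⟩ := (hF.image norm).bddAbove
    exact ⟨max K 1, by positivity, fun x hx =>
      (hK (Set.mem_image_of_mem _ hx)).trans (le_max_left _ _)⟩
  obtain ⟨r, hr, hexp'⟩ := exists_norm_exp_sub_one_sub_le (A := A) (c := ε / (4 * K * s))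
    (by positivity)
  obtain ⟨k, hk0, hkr, hkε⟩ : ∃ k : ℕ, 0 < k ∧ s / k ≤ r ∧ (1 + ε / (4 * K * s)) * (s / k) ≤ ε := by
    have t1 : Tendsto (fun k : ℕ => s / (k : ℝ)) atTop (𝓝 0) := tendsto_const_div_atTop_nhds_zero_nat s
    have t2 := t1.const_mul (1 + ε / (4 * K * s))
    rw [mul_zero] at t2
    exact ((eventually_gt_atTop 0).and ((t1.eventually_le_const hr).and
      (t2.eventually_le_const hε))).exists
  have hev : ∀ᶠ n in atTop, ∀ x ∈ F, s / M * ‖a n * x - x * a n‖ ≤ ε / 2 := by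
    refine (eventually_all_finite hF).2 fun x _ => ?_
    have := (hc x).norm.const_mul (s / M)
    rw [norm_zero, mul_zero] at this
    exact this.eventually_le_const (by positivity)
  obtain ⟨n, hfar, hn⟩ := (hfreq.and_eventually hev).exists
  have hk : (0 : ℝ) < k := by exact_mod_cast hk0
  let t : ℝ := s / M / k
  have ht : 0 < t := by positivity
  have hta : IsSelfAdjoint (t • a n) := (IsSelfAdjoint.all t).smul (hsa n)
  let v : unitary A := selfAdjoint.expUnitary ⟨t • a n, hta⟩
  set b : A := Complex.I • t • a n with hb
  have hv : (v : A) = NormedSpace.exp b := rfl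
  have hbn : ‖b‖ = t * ‖a n‖ := by
    rw [hb, norm_smul, norm_smul, Complex.norm_I, one_mul, Real.norm_of_nonneg ht.le]
  have hbk : ‖b‖ ≤ s / k := by
    rw [hbn]
    calc t * ‖a n‖ ≤ t * M := by gcongr; exact hM n
      _ = s / k := by simp only [t]; field_simp
  have hd := hexp' b (hbk.trans hkr)
  refine ⟨v, k, ?_, fun j hj x hx => ?_, fun z hz => ?_⟩
  · calc ‖(v : A) - 1‖ = ‖(NormedSpace.exp b - 1 - b) + b‖ := by rw [hv]; congr 1; abel
      _ ≤ ε / (4 * K * s) * ‖b‖ + ‖b‖ := (norm_add_le _ _).trans (by gcongr)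
      _ = (1 + ε / (4 * K * s)) * ‖b‖ := by ring
      _ ≤ (1 + ε / (4 * K * s)) * (s / k) := by gcongr
      _ ≤ ε := hkε
  · have e : (v : A) * x - x * (v : A) = (NormedSpace.exp b - 1 - b) * x -
        x * (NormedSpace.exp b - 1 - b) + (b * x - x * b) := by
      rw [hv]; noncomm_ring
    have e2 : b * x - x * b = Complex.I • t • (a n * x - x * a n) := by
      simp only [hb, smul_sub, smul_mul_assoc, mul_smul_comm]
    have h2 : ‖b * x - x * b‖ = t * ‖a n * x - x * a n‖ := by
      rw [e2, norm_smul, norm_smul, Complex.norm_I, one_mul, Real.norm_of_nonneg ht.le]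
    have hx' := hK x hx
    have h3 : ‖(NormedSpace.exp b - 1 - b) * x‖ ≤ ε / (4 * K * s) * (s / k) * K :=
      (norm_mul_le _ _).trans (by gcongr; exact hd.trans (by gcongr))
    have h4 : ‖x * (NormedSpace.exp b - 1 - b)‖ ≤ ε / (4 * K * s) * (s / k) * K := by
      refine (norm_mul_le _ _).trans ?_
      rw [mul_comm]
      gcongr
      exact hd.trans (by gcongr)
    have h5 : ε / (4 * K * s) * (s / k) * K = ε / 4 / k := by field_simp
    have h6 : t * ‖a n * x - x * a n‖ ≤ ε / 2 / k := by
      have := hn x hx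
      simp only [t]
      rw [div_mul_eq_mul_div]
      gcongr
    have h7 : ‖(v : A) * x - x * (v : A)‖ ≤ ε / k := by
      rw [e]
      refine (norm_add_le _ _).trans ?_
      have := norm_sub_le ((NormedSpace.exp b - 1 - b) * x) (x * (NormedSpace.exp b - 1 - b))
      have h8 : ε / k = ε / 4 / k + ε / 4 / k + ε / 2 / k := by ring
      rw [h8, h2]
      linarith
    refine (norm_commutator_pow_le v x j).trans ?_
    calc (j : ℝ) * ‖(v : A) * x - x * (v : A)‖ ≤ k * (ε / k) := by gcongr
      _ = ε := by field_simp
  · have hpow : ((v ^ k : unitary A) : A) = NormedSpace.exp ((k : ℕ) • b) := by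
      let +nondep : NormedAlgebra ℚ A := NormedAlgebra.restrictScalars ℚ ℂ A
      rw [NormedSpace.exp_nsmul, ← hv]
      simp
    have hkb : (k : ℕ) • b = Complex.I • (s / M) • a n := by
      rw [hb, ← Nat.cast_smul_eq_nsmul ℝ, smul_comm, smul_smul]
      congr 2
      simp only [t]; field_simp
    have hn' : ‖Complex.I • (s / M) • a n‖ = s / M * ‖a n‖ := by
      rw [norm_smul, norm_smul, Complex.norm_I, one_mul, Real.norm_of_nonneg (by positivity)]
    have hle : s / M * ‖a n‖ ≤ s := by
      calc s / M * ‖a n‖ ≤ s / M * M := by gcongr; exact hM n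
        _ = s := by field_simp
    have hd' := hexp (Complex.I • (s / M) • a n) (by rw [hn']; exact hle)
    rw [hn'] at hd'
    have hd'' : δ / (2 * M) * (s / M * ‖a n‖) ≤ s / M * δ / 2 := by
      calc δ / (2 * M) * (s / M * ‖a n‖) ≤ δ / (2 * M) * s := by gcongr
        _ = s / M * δ / 2 := by field_simp
    rw [hpow, hkb]
    have hsM : (0 : ℝ) < s / M := by positivity
    have hmain : s / M * δ ≤ ‖Complex.I • (s / M) • a n - (z - 1)‖ := by
      have hne : (Complex.I • ((s / M : ℝ) : ℂ)) ≠ 0 := by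
        simp [hs.ne', hM0.ne']
      have e : Complex.I • (s / M) • a n - (z - 1) = (Complex.I • ((s / M : ℝ) : ℂ)) •
          (a n - (Complex.I • ((s / M : ℝ) : ℂ))⁻¹ • (z - 1)) := by
        rw [smul_sub, smul_smul, mul_inv_cancel₀ hne, one_smul, smul_assoc]
        rfl
      rw [e, norm_smul, norm_smul, Complex.norm_I, one_mul, Complex.norm_of_nonneg hsM.le]
      gcongr
      exact hfar _ ((Subalgebra.center ℂ A).smul_mem (sub_mem hz (one_mem _)) _)
    have htri : ‖Complex.I • (s / M) • a n - (z - 1)‖ ≤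
        ‖NormedSpace.exp (Complex.I • (s / M) • a n) - z‖ +
          ‖NormedSpace.exp (Complex.I • (s / M) • a n) - 1 - Complex.I • (s / M) • a n‖ := by
      have e : Complex.I • (s / M) • a n - (z - 1) =
        (NormedSpace.exp (Complex.I • (s / M) • a n) - z) -
          (NormedSpace.exp (Complex.I • (s / M) • a n) - 1 - Complex.I • (s / M) • a n) := by abel
      nth_rewrite 1 [e]
      exact norm_sub_le _ _
    linarith

end CentralUnitaries

section ProductAutomorphisms

variable {A : Type*} [CStarAlgebra A]

/-- The partial products of the powers of the unitaries `v n`, with exponents given by `t` and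
truncated to `[0, m n]`. -/
def partialProd (v : ℕ → unitary A) (m : ℕ → ℕ) (t : ℕ → ℤ) : ℕ → unitary A
  | 0 => 1
  | n + 1 => partialProd v m t n * v n ^ min (t n).toNat (m n)

/-- Unitaries whose truncated products define automorphisms on a given sequence of elements. -/
structure IsFastCentral (v : ℕ → unitary A) (m : ℕ → ℕ) (x : ℕ → A) : Prop where
  norm_sub_one_le : ∀ n, ‖(v n : A) - 1‖ ≤ (1 / 2) ^ n
  norm_commutator_le : ∀ n, ∀ k ≤ n, ∀ j ≤ m n,
    ‖((v n ^ j : unitary A) : A) * x k - x k * ((v n ^ j : unitary A) : A)‖ ≤ (1 / 2) ^ n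
  norm_commutator_conj_le : ∀ n, ∀ k ≤ n, ∀ j ≤ m n, ∀ t : ℕ → ℤ,
    ‖((v n ^ j : unitary A) : A) *
        (star (partialProd v m t n : A) * x k * (partialProd v m t n : A)) -
      (star (partialProd v m t n : A) * x k * (partialProd v m t n : A)) *
        ((v n ^ j : unitary A) : A)‖ ≤ (1 / 2) ^ n

theorem exists_isFastCentral (h : ¬ HasContinuousTrace A) (x : ℕ → A) :
    ∃ δ > 0, ∃ (v : ℕ → unitary A) (m : ℕ → ℕ), IsFastCentral v m x ∧
      ∀ n, ∀ z ∈ Subalgebra.center ℂ A, δ ≤ ‖((v n ^ m n : unitary A) : A) - z‖ := by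
  obtain ⟨δ, hδ, hU⟩ := exists_unitary_powers h
  refine ⟨δ, hδ, ?_⟩
  let F : ℕ → {V : Set (unitary A) // V.Finite} → Set A := fun n V =>
    x '' Set.Iic n ∪ Set.image2 (fun (u : unitary A) k => star (u : A) * x k * (u : A)) V.1 (Set.Iic n)
  have hF : ∀ n V, (F n V).Finite := fun n V =>
    ((Set.finite_Iic n).image x).union (Set.Finite.image2 _ V.2 (Set.finite_Iic n))
  have hstep : ∀ (n : ℕ) (V : {V : Set (unitary A) // V.Finite}), ∃ (v : unitary A) (m : ℕ),
      ‖(v : A) - 1‖ ≤ (1 / 2) ^ n ∧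
      (∀ j ≤ m, ∀ y ∈ F n V,
        ‖((v ^ j : unitary A) : A) * y - y * ((v ^ j : unitary A) : A)‖ ≤ (1 / 2) ^ n) ∧
      ∀ z ∈ Subalgebra.center ℂ A, δ ≤ ‖((v ^ m : unitary A) : A) - z‖ := fun n V =>
    hU (F n V) (hF n V) _ (by positivity)
  choose v m hv1 hv2 hv3 using hstep
  let V : ℕ → {V : Set (unitary A) // V.Finite} := fun n => Nat.rec ⟨{1}, Set.finite_singleton 1⟩
    (fun n V => ⟨Set.image2 (fun u j => u * v n V ^ j) V.1 (Set.Iic (m n V)),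
      Set.Finite.image2 _ V.2 (Set.finite_Iic _)⟩) n
  have hV : ∀ t n, partialProd (fun n => v n (V n)) (fun n => m n (V n)) t n ∈ (V n).1 := by
    intro t n
    induction n with
    | zero => exact Set.mem_singleton _
    | succ n ih => exact Set.mem_image2_of_mem ih (Set.mem_Iic.2 (min_le_right _ _))
  refine ⟨fun n => v n (V n), fun n => m n (V n), ⟨fun n => hv1 n _, ?_, ?_⟩, fun n => hv3 n _⟩
  · intro n k hk j hj
    exact hv2 n _ j hj _ (Or.inl (Set.mem_image_of_mem _ hk))
  · intro n k hk j hj t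
    exact hv2 n _ j hj _ (Or.inr (Set.mem_image2_of_mem (hV t n) hk))

theorem norm_starAlgEquiv (α : A ≃⋆ₐ[ℂ] A) (x : A) : ‖α x‖ = ‖x‖ :=
  NonUnitalStarAlgHom.norm_map (α : A →⋆ₐ[ℂ] A) α.injective x

/-- Approximate pointwise Cauchy-ness of isometries extends from a dense sequence. -/
theorem cauchySeq_of_denseRange {x : ℕ → A} (hx : DenseRange x) (α : ℕ → A ≃⋆ₐ[ℂ] A)
    (h : ∀ k, CauchySeq fun n => α n (x k)) (y : A) : CauchySeq fun n => α n y := by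
  rw [Metric.cauchySeq_iff]
  intro ε hε
  obtain ⟨k, hk⟩ := hx.exists_dist_lt y (show 0 < ε / 3 by positivity)
  obtain ⟨N, hN⟩ := Metric.cauchySeq_iff.1 (h k) (ε / 3) (by positivity)
  refine ⟨N, fun i hi j hj => ?_⟩
  have h1 : ∀ i, dist (α i y) (α i (x k)) < ε / 3 := fun i => by
    rwa [dist_eq_norm, ← map_sub, norm_starAlgEquiv, ← dist_eq_norm]
  have h2 := h1 j
  rw [dist_comm] at h2
  have := dist_triangle4 (α i y) (α i (x k)) (α j (x k)) (α j y)
  linarith [h1 i, hN i hi j hj]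

/-- A sequence of automorphisms which together with the inverses is pointwise Cauchy converges
pointwise to an automorphism. -/
theorem exists_tendsto_starAlgEquiv (α : ℕ → A ≃⋆ₐ[ℂ] A) (h : ∀ y, CauchySeq fun n => α n y)
    (h' : ∀ y, CauchySeq fun n => (α n).symm y) :
    ∃ β : A ≃⋆ₐ[ℂ] A, ∀ y, Tendsto (fun n => α n y) atTop (𝓝 (β y)) := by
  choose f hf using fun y => cauchySeq_tendsto_of_complete (h y)
  choose g hg using fun y => cauchySeq_tendsto_of_complete (h' y)
  have hgf : ∀ y, g (f y) = y := by
    intro y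
    refine tendsto_nhds_unique (hg (f y)) ?_
    rw [tendsto_iff_norm_sub_tendsto_zero]
    have := tendsto_iff_norm_sub_tendsto_zero.1 (hf y)
    refine this.congr fun n => ?_
    rw [← norm_starAlgEquiv (α n) ((α n).symm (f y) - y), map_sub, StarAlgEquiv.apply_symm_apply,
      norm_sub_rev]
  have hfg : ∀ y, f (g y) = y := by
    intro y
    refine tendsto_nhds_unique (hf (g y)) ?_
    rw [tendsto_iff_norm_sub_tendsto_zero]
    have := tendsto_iff_norm_sub_tendsto_zero.1 (hg y)
    refine this.congr fun n => ?_
    rw [← norm_starAlgEquiv (α n) ((α n).symm y - g y), map_sub, StarAlgEquiv.apply_symm_apply,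
      norm_sub_rev]
  refine ⟨{ toFun := f, invFun := g, left_inv := hgf, right_inv := hfg,
            map_mul' := fun a b => ?_, map_add' := fun a b => ?_,
            map_star' := fun a => ?_, map_smul' := fun c a => ?_ }, hf⟩
  · refine tendsto_nhds_unique (hf (a * b)) ?_
    simpa only [map_mul] using (hf a).mul (hf b)
  · refine tendsto_nhds_unique (hf (a + b)) ?_
    simpa only [map_add] using (hf a).add (hf b)
  · refine tendsto_nhds_unique (hf (star a)) ?_
    simpa only [map_star] using (hf a).star
  · refine tendsto_nhds_unique (hf (c • a)) ?_
    simpa only [map_smul] using (hf a).const_smul c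

theorem norm_conj_sub (u v : unitary A) (y : A) :
    ‖((u * v : unitary A) : A) * y * star ((u * v : unitary A) : A) - (u : A) * y * star (u : A)‖ =
      ‖(v : A) * y - y * (v : A)‖ := by
  have e : ((u * v : unitary A) : A) * y * star ((u * v : unitary A) : A) -
      (u : A) * y * star (u : A) =
      (u : A) * (((v : A) * y - y * (v : A)) * ((star v : unitary A) : A)) *
        ((star u : unitary A) : A) := by
    have hv : (v : A) * star (v : A) = 1 := Unitary.mul_star_self_of_mem v.2
    simp only [Submonoid.coe_mul, Unitary.coe_star, star_mul, sub_mul, mul_sub, mul_assoc]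
    rw [← mul_assoc (v : A) (star (v : A)), hv, one_mul]
  rw [e, CStarRing.norm_mul_coe_unitary, CStarRing.norm_coe_unitary_mul,
    CStarRing.norm_mul_coe_unitary]

theorem norm_conj_star_sub (v : unitary A) (y : A) :
    ‖star (v : A) * y * (v : A) - y‖ = ‖(v : A) * y - y * (v : A)‖ := by
  rw [norm_sub_rev, ← CStarRing.norm_coe_unitary_mul v]
  have hv : (v : A) * star (v : A) = 1 := Unitary.mul_star_self_of_mem v.2
  congr 1
  rw [mul_sub, ← mul_assoc, ← mul_assoc, hv, one_mul]

theorem summable_half_pow : Summable fun n : ℕ => (1 / 2 : ℝ) ^ n := summable_geometric_two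

theorem cauchySeq_of_norm_sub_le {f : ℕ → A} {k : ℕ}
    (h : ∀ n, k ≤ n → ‖f (n + 1) - f n‖ ≤ (1 / 2) ^ n) : CauchySeq f := by
  refine cauchySeq_of_summable_dist ?_
  refine Summable.of_norm_bounded_eventually_nat summable_half_pow ?_
  filter_upwards [eventually_ge_atTop k] with n hn
  rw [Real.norm_of_nonneg dist_nonneg, dist_comm, dist_eq_norm]
  exact h n hn

theorem norm_sub_le_of_tendsto {f : ℕ → A} {y : A} {k : ℕ}
    (h : ∀ n, k ≤ n → ‖f (n + 1) - f n‖ ≤ (1 / 2) ^ n) (hy : Tendsto f atTop (𝓝 y)) {n : ℕ}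
    (hn : k ≤ n) : ‖y - f n‖ ≤ 2 * (1 / 2) ^ n := by
  have key : ∀ N, n ≤ N → ‖f N - f n‖ ≤ 2 * (1 / 2) ^ n - 2 * (1 / 2) ^ N := by
    intro N hN
    induction N, hN using Nat.le_induction with
    | base => simp
    | succ N hN ih =>
      have e : f (N + 1) - f n = (f (N + 1) - f N) + (f N - f n) := by abel
      rw [e]
      refine (norm_add_le _ _).trans ?_
      have := h N (hn.trans hN)
      rw [pow_succ]
      linarith
  refine le_of_tendsto (hy.sub_const (f n)).norm ?_
  filter_upwards [eventually_ge_atTop n] with N hN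
  refine (key N hN).trans ?_
  have : (0 : ℝ) ≤ (1 / 2) ^ N := by positivity
  linarith

variable {v : ℕ → unitary A} {m : ℕ → ℕ} {x : ℕ → A}

theorem IsFastCentral.norm_step_le (h : IsFastCentral v m x) (t : ℕ → ℤ) {k n : ℕ} (hk : k ≤ n) :
    ‖Unitary.conjStarAlgAut ℂ A (partialProd v m t (n + 1)) (x k) -
      Unitary.conjStarAlgAut ℂ A (partialProd v m t n) (x k)‖ ≤ (1 / 2) ^ n := by
  simp only [Unitary.conjStarAlgAut_apply, partialProd]
  rw [norm_conj_sub]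
  exact h.norm_commutator_le n k hk _ (min_le_right _ _)

theorem IsFastCentral.exists_tendsto (h : IsFastCentral v m x) (hx : DenseRange x) (t : ℕ → ℤ) :
    ∃ β : A ≃⋆ₐ[ℂ] A, ∀ y, Tendsto
      (fun n => Unitary.conjStarAlgAut ℂ A (partialProd v m t n) y) atTop (𝓝 (β y)) := by
  refine exists_tendsto_starAlgEquiv _ (cauchySeq_of_denseRange hx _ fun k => ?_)
    (cauchySeq_of_denseRange hx (fun n => (Unitary.conjStarAlgAut ℂ A (partialProd v m t n)).symm)
      fun k => ?_)
  · exact cauchySeq_of_norm_sub_le fun n hn => h.norm_step_le t hn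
  · refine cauchySeq_of_norm_sub_le (k := k) fun n hn => ?_
    simp only [Unitary.conjStarAlgAut_symm_apply, partialProd]
    have := h.norm_commutator_conj_le n k hn _ (min_le_right (t n).toNat (m n)) t
    rw [← norm_conj_star_sub] at this
    convert this using 2
    simp only [Submonoid.coe_mul, star_mul, mul_assoc]

theorem partialProd_congr {t t' : ℕ → ℤ} {n : ℕ} (h : ∀ i < n, t' i = t i) :
    partialProd v m t' n = partialProd v m t n := by
  induction n with
  | zero => rfl
  | succ n ih =>
    simp only [partialProd]
    rw [ih fun i hi => h i (by omega), h n (by omega)]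

/-- The limit automorphisms depend continuously on the exponents. -/
theorem IsFastCentral.continuous_limit (h : IsFastCentral v m x) (hx : DenseRange x)
    {f : (ℕ → ℤ) → (A ≃⋆ₐ[ℂ] A)}
    (hf : ∀ t y, Tendsto (fun n => Unitary.conjStarAlgAut ℂ A (partialProd v m t n) y) atTop
      (𝓝 (f t y))) : Continuous f := by
  refine continuous_induced_rng.2 (continuous_pi fun y => continuous_iff_continuousAt.2 fun t => ?_)
  rw [ContinuousAt, Metric.tendsto_nhds]
  intro ε hε
  obtain ⟨k, hk⟩ := hx.exists_dist_lt y (show 0 < ε / 4 by positivity)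
  have hlim : Tendsto (fun n : ℕ => 4 * (1 / 2 : ℝ) ^ n) atTop (𝓝 0) := by
    have := (tendsto_pow_atTop_nhds_zero_of_lt_one (r := (1 / 2 : ℝ)) (by norm_num)
      (by norm_num)).const_mul 4
    rwa [mul_zero] at this
  obtain ⟨n, hkn, hn⟩ := ((eventually_ge_atTop k).and
    (hlim.eventually_lt_const (show 0 < ε / 2 by positivity))).exists
  have hcyl := (PiNat.isOpen_cylinder (fun _ => ℤ) t n).mem_nhds (PiNat.self_mem_cylinder t n)
  filter_upwards [hcyl] with t' ht'
  have h1 := norm_sub_le_of_tendsto (fun n hn => h.norm_step_le t' hn) (hf t' (x k)) hkn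
  have h2 := norm_sub_le_of_tendsto (fun n hn => h.norm_step_le t hn) (hf t (x k)) hkn
  rw [partialProd_congr ht'] at h1
  have h3 : ∀ s, dist (f s y) (f s (x k)) < ε / 4 := fun s => by
    rwa [dist_eq_norm, ← map_sub, norm_starAlgEquiv, ← dist_eq_norm]
  have h4 := h3 t
  rw [dist_comm] at h4
  rw [← dist_eq_norm] at h1 h2
  rw [dist_comm] at h2
  have h5 := dist_triangle4 (f t' y) (f t' (x k)) (f t (x k)) (f t y)
  have h6 := dist_triangle (f t' (x k))
    (Unitary.conjStarAlgAut ℂ A (partialProd v m t n) (x k)) (f t (x k))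
  simp only [Function.comp_apply]
  linarith [h3 t']

theorem norm_pow_sub_pow_le (w : unitary A) {i j : ℕ} (hij : i ≤ j) (hj : j ≤ i + 1) :
    ‖((w ^ j : unitary A) : A) - ((w ^ i : unitary A) : A)‖ ≤ ‖(w : A) - 1‖ := by
  obtain rfl | rfl : j = i ∨ j = i + 1 := by omega
  · simp
  · have e : ((w ^ (i + 1) : unitary A) : A) - ((w ^ i : unitary A) : A) =
        ((w ^ i : unitary A) : A) * ((w : A) - 1) := by
      rw [pow_succ, Submonoid.coe_mul, mul_sub, mul_one]
    rw [e, CStarRing.norm_coe_unitary_mul]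

/-- Bounded perturbations of the exponents do not change the unitary equivalence class of the
limit automorphism. -/
theorem IsFastCentral.unitaryEquivalence_limit (h : IsFastCentral v m x)
    {f : (ℕ → ℤ) → (A ≃⋆ₐ[ℂ] A)}
    (hf : ∀ t y, Tendsto (fun n => Unitary.conjStarAlgAut ℂ A (partialProd v m t n) y) atTop
      (𝓝 (f t y))) (l : ℕ → ℕ) (t : ℕ → ℤ) : unitaryEquivalence A (f (t + bits l)) (f t) := by
  set p := partialProd v m t with hp
  set q := partialProd v m (t + bits l) with hq
  let w : ℕ → unitary A := fun n => q n * star (p n)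
  have hw : CauchySeq fun n => (w n : A) := by
    refine cauchySeq_of_norm_sub_le (k := 0) fun n _ => ?_
    set i := min (t n).toNat (m n) with hi
    set j := min ((t + bits l) n).toNat (m n) with hj
    have hij : i ≤ j ∧ j ≤ i + 1 := by
      have : (t + bits l) n = t n ∨ (t + bits l) n = t n + 1 := by
        simp only [Pi.add_apply, bits]
        split_ifs <;> simp
      omega
    have e : (w (n + 1) : A) - (w n : A) = (q n : A) *
        (((((v n ^ j : unitary A) : A) - ((v n ^ i : unitary A) : A)) *
          ((star (v n ^ i) : unitary A) : A)) * ((star (p n) : unitary A) : A)) := by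
      have h1 : w (n + 1) = q n * (v n ^ j * (star (v n ^ i) * star (p n))) := by
        simp only [w, hq, hp, partialProd, star_mul, mul_assoc, hi, hj]
      have h2 : ((v n ^ i : unitary A) : A) * ((star (v n ^ i) : unitary A) : A) = 1 :=
        Unitary.mul_star_self_of_mem (v n ^ i).2
      rw [h1, sub_mul, h2]
      simp only [w, Submonoid.coe_mul, sub_mul, mul_sub, one_mul, mul_assoc]
    rw [e, CStarRing.norm_coe_unitary_mul, CStarRing.norm_mul_coe_unitary,
      CStarRing.norm_mul_coe_unitary]
    exact (norm_pow_sub_pow_le _ hij.1 hij.2).trans (h.norm_sub_one_le n)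
  obtain ⟨u, hu⟩ := cauchySeq_tendsto_of_complete hw
  have huU : u ∈ unitary A :=
    (isClosed_unitary (R := A)).mem_of_tendsto hu (Eventually.of_forall fun n => (w n).2)
  refine ⟨⟨u, huU⟩, ?_⟩
  ext y
  refine tendsto_nhds_unique (hf (t + bits l) y) ?_
  have := (hu.mul (hf t y)).mul hu.star
  refine this.congr fun n => ?_
  have hpp : star (p n) * p n = 1 := Unitary.star_mul_self _
  have hqq : w n * p n = q n := by simp only [w, mul_assoc, hpp, mul_one]
  rw [← hp, ← hq, ← hqq]
  simp only [Unitary.conjStarAlgAut_apply, Submonoid.coe_mul, star_mul, mul_assoc]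

/-- Increasing one exponent from `0` to its largest value changes the limit automorphism by an
inner automorphism given by a unitary conjugate to a power of the corresponding unitary. -/
theorem limit_add_single {f : (ℕ → ℤ) → (A ≃⋆ₐ[ℂ] A)}
    (hf : ∀ t y, Tendsto (fun n => Unitary.conjStarAlgAut ℂ A (partialProd v m t n) y) atTop
      (𝓝 (f t y))) {t : ℕ → ℤ} {n : ℕ} (ht : t n = 0) :
    f (t + Pi.single n (m n : ℤ)) = Unitary.conjStarAlgAut ℂ A
      (partialProd v m t n * v n ^ m n * star (partialProd v m t n)) * f t := by
  set t' := t + Pi.single n (m n : ℤ) with ht'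
  set w := partialProd v m t n * v n ^ m n * star (partialProd v m t n) with hw
  have hne : ∀ i, i ≠ n → t' i = t i := fun i hi => by simp [ht', hi]
  have hprod : ∀ N, n + 1 ≤ N → partialProd v m t' N = w * partialProd v m t N := by
    intro N hN
    induction N, hN using Nat.le_induction with
    | base =>
      have h1 : t' n = m n := by simp [ht', ht]
      simp only [partialProd]
      rw [partialProd_congr (t := t) (t' := t') fun i hi => hne i (by omega), h1, ht, hw]
      simp [mul_assoc]
    | succ N hN ih =>
      simp only [partialProd]
      rw [ih, hne N (by omega), mul_assoc]
  ext y
  refine tendsto_nhds_unique (hf t' y) ?_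
  have := ((tendsto_const_nhds (x := (w : A))).mul (hf t y)).mul_const (star (w : A))
  refine this.congr' ?_
  filter_upwards [eventually_ge_atTop (n + 1)] with N hN
  rw [hprod N hN]
  simp only [Unitary.conjStarAlgAut_apply, Submonoid.coe_mul, star_mul, mul_assoc]

end ProductAutomorphisms

section Nonclassification

variable {A : Type*} [CStarAlgebra A]

instance : BorelSpace (A ≃⋆ₐ[ℂ] A) := ⟨rfl⟩

/-- If there is a nontrivial central sequence, then unitary equivalence of automorphisms is not
classifiable by countable structures. -/
theorem not_classifiable_of_not_hasContinuousTrace [TopologicalSpace.SeparableSpace A]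
    (h : ¬ HasContinuousTrace A) :
    ¬ ClassifiableByCountableStructures (unitaryEquivalence A) := by
  rintro ⟨L, -, hL, g, hg, hgE⟩
  obtain ⟨δ, hδ, v, m, hfast, hfar⟩ := exists_isFastCentral h (TopologicalSpace.denseSeq A)
  have hdense := TopologicalSpace.denseRange_denseSeq A
  choose f hf using hfast.exists_tendsto hdense
  have hfc : Continuous f := hfast.continuous_limit hdense hf
  obtain ⟨C, hC, hCiso⟩ := exists_residual_isoSetoid (h := g ∘ f) (hg.comp hfc.measurable)
    fun l x => (hgE _ _).2 (hfast.unitaryEquivalence_limit hf l x)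
  have : SecondCountableTopology A := UniformSpace.secondCountable_of_separable A
  obtain ⟨s, hs⟩ := (dense_of_mem_residual hC).nonempty
  let S : ℕ → Set (ℕ → ℤ) := fun j => {t | ∃ u ∈ unitary A,
    dist u (TopologicalSpace.denseSeq A j) ≤ δ / 3 ∧ ∀ y, f t y = u * f s y * star u}
  have hCS : C ⊆ ⋃ j, S j := by
    intro t ht
    obtain ⟨u, hu⟩ := (hgE _ _).1 (hCiso t ht s hs)
    obtain ⟨j, hj⟩ := hdense.exists_dist_lt (u : A) (show 0 < δ / 3 by positivity)
    refine Set.mem_iUnion.2 ⟨j, u, u.2, hj.le, fun y => ?_⟩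
    rw [hu]
    simp
  have hSa : ∀ j, MeasureTheory.AnalyticSet (S j) := by
    intro j
    have hcl : IsClosed {p : (ℕ → ℤ) × A | p.2 ∈ unitary A ∧
        dist p.2 (TopologicalSpace.denseSeq A j) ≤ δ / 3 ∧
          ∀ y, f p.1 y = p.2 * f s y * star p.2} := by
      refine ((isClosed_unitary (R := A)).preimage continuous_snd).inter
        ((isClosed_le (continuous_snd.dist continuous_const) continuous_const).inter ?_)
      have : {p : (ℕ → ℤ) × A | ∀ y, f p.1 y = p.2 * f s y * star p.2} =
          ⋂ y, {p | f p.1 y = p.2 * f s y * star p.2} := by ext; simp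
      have hy : ∀ y, Continuous fun t => f t y := fun y =>
        (continuous_apply y).comp (continuous_induced_dom.comp hfc)
      have hcl : IsClosed {p : (ℕ → ℤ) × A | ∀ y, f p.1 y = p.2 * f s y * star p.2} := by
        rw [this]
        exact isClosed_iInter fun y => isClosed_eq ((hy y).comp continuous_fst) (by fun_prop)
      exact hcl
    convert hcl.analyticSet.image_of_continuous continuous_fst using 1
    ext t
    simp [S]
  obtain ⟨j, hj⟩ : ∃ j, ¬ IsMeagre (S j) := by
    by_contra! hcon
    have h1 : IsMeagre C := (isMeagre_iUnion hcon).mono hCS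
    obtain ⟨t, ht, ht'⟩ := (dense_of_mem_residual (inter_mem hC h1)).nonempty
    exact ht' ht
  obtain ⟨W, hW, hSW⟩ := (baireMeasurableSet_of_analyticSet (hSa j)).residualEq_isOpen
  have hSW := eventuallyEq_set.1 hSW
  obtain ⟨z, hz⟩ : W.Nonempty := by
    by_contra! hcon
    apply hj
    filter_upwards [hSW] with t ht hts
    simpa [hcon] using ht.1 hts
  obtain ⟨n, hn⟩ := exists_cylinder_subset hW hz
  set e : ℕ → ℤ := Pi.single n (m n : ℤ) with he
  have hSW' : ∀ᶠ t in residual (ℕ → ℤ), (t + e ∈ S j ↔ t + e ∈ W) :=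
    tendsto_residual_of_isOpenMap (Homeomorph.addRight e).continuous
      (Homeomorph.addRight e).isOpenMap hSW
  obtain ⟨t, htc, ht1, ht2⟩ := (dense_of_mem_residual (hSW.and hSW')).inter_open_nonempty _
    (PiNat.isOpen_cylinder (fun _ => ℤ) (Function.update z n 0) (n + 1))
    ⟨_, PiNat.self_mem_cylinder _ _⟩
  have htn : t n = 0 := by simpa using htc n (by omega)
  have htz : ∀ i < n, t i = z i := fun i hi => by
    simpa [hi.ne] using htc i (by omega)
  obtain ⟨u, hu, hud, hut⟩ := ht1.2 (hn htz)
  obtain ⟨u', hu', hud', hut'⟩ := ht2.2 (hn fun i hi => by simp [he, hi.ne, htz i hi])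
  rw [limit_add_single hf htn] at hut'
  set p := partialProd v m t n
  let U : unitary A := ⟨u, hu⟩
  let U' : unitary A := ⟨u', hu'⟩
  let c : unitary A := star U' * (p * v n ^ m n * star p) * U
  have hc : (c : A) ∈ Subalgebra.center ℂ A := by
    rw [Subalgebra.mem_center_iff]
    intro b
    obtain ⟨y, rfl⟩ := (f s).surjective b
    have h1 := hut' y
    rw [StarAlgEquiv.mul_apply, hut y] at h1
    have h2 : Unitary.conjStarAlgAut ℂ A ((p * v n ^ m n * star p) * U) (f s y) =
        Unitary.conjStarAlgAut ℂ A U' (f s y) := by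
      rw [Unitary.conjStarAlgAut_mul_apply]
      exact h1
    have h3 : Unitary.conjStarAlgAut ℂ A c (f s y) = f s y := by
      have : c = star U' * ((p * v n ^ m n * star p) * U) := by simp only [c, mul_assoc]
      rw [this, Unitary.conjStarAlgAut_mul_apply, h2, ← Unitary.conjStarAlgAut_mul_apply,
        Unitary.star_mul_self, map_one, StarAlgEquiv.one_apply]
    rw [Unitary.conjStarAlgAut_apply] at h3
    have hcc : star (c : A) * (c : A) = 1 := Unitary.star_mul_self_of_mem c.2
    calc f s y * (c : A) = (c : A) * f s y * star (c : A) * (c : A) := by rw [h3]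
      _ = (c : A) * f s y := by rw [mul_assoc, hcc, mul_one]
  have hdist : ‖((v n ^ m n : unitary A) : A) - (c : A)‖ = ‖u' - u‖ := by
    have e1 : ((v n ^ m n : unitary A) : A) - c =
        ((star p : unitary A) : A) * ((((U' : A) - (U : A)) * ((star U : unitary A) : A)) *
          (p : A)) * (c : A) := by
      have h1 : v n ^ m n = star p * (U' * (c * (star U * p))) := by
        simp only [c, Unitary.star_eq_inv]
        group
      have h2 : (c : A) * ((star U * p : unitary A) : A) = ((star U * p : unitary A) : A) * c :=
        (Subalgebra.mem_center_iff.1 hc _).symm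
      have h3 : star p * (U * (star U * p)) = 1 := by
        simp only [Unitary.star_eq_inv]
        group
      have h4 : ((star p : unitary A) : A) * ((U : A) * ((star U * p : unitary A) : A)) = 1 :=
        congrArg Subtype.val h3
      rw [h1]
      simp only [Submonoid.coe_mul] at h2 h4 ⊢
      rw [h2]
      simp only [sub_mul, mul_sub, mul_assoc] at h4 ⊢
      congr 1
      calc (c : A) = 1 * (c : A) := (one_mul _).symm
        _ = _ := by rw [← h4]; simp only [mul_assoc]
    rw [e1, CStarRing.norm_mul_coe_unitary, CStarRing.norm_coe_unitary_mul,
      CStarRing.norm_mul_coe_unitary, CStarRing.norm_mul_coe_unitary]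
  have := hfar n _ hc
  rw [hdist, ← dist_eq_norm] at this
  have := dist_triangle_right u' u (TopologicalSpace.denseSeq A j)
  linarith

end Nonclassification

section Smooth

variable {A : Type*} [CStarAlgebra A]

theorem continuous_aut_eval (y : A) : Continuous fun α : A ≃⋆ₐ[ℂ] A => α y :=
  (continuous_apply y).comp continuous_induced_dom

theorem continuous_aut_iff {X : Type*} [TopologicalSpace X] {f : X → A ≃⋆ₐ[ℂ] A} :
    Continuous f ↔ ∀ y, Continuous fun t => f t y :=
  continuous_induced_rng.trans continuous_pi_iff

theorem isInducing_aut_denseRange {x : ℕ → A} (hx : DenseRange x) :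
    IsInducing fun (α : A ≃⋆ₐ[ℂ] A) k => α (x k) := by
  refine ⟨le_antisymm (continuous_iff_le_induced.1
    (continuous_pi fun k => continuous_aut_eval (x k))) ?_⟩
  refine continuous_iff_le_induced.1 ?_
  let _ : TopologicalSpace (A ≃⋆ₐ[ℂ] A) :=
    TopologicalSpace.induced (fun α k => α (x k)) inferInstance
  have hk : ∀ k, Continuous fun α : A ≃⋆ₐ[ℂ] A => α (x k) :=
    continuous_pi_iff.1 continuous_induced_dom
  refine continuous_pi fun y => continuous_iff_continuousAt.2 fun α => ?_
  rw [ContinuousAt, Metric.tendsto_nhds]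
  intro ε hε
  obtain ⟨k, hky⟩ := hx.exists_dist_lt y (show 0 < ε / 3 by positivity)
  have h3 : ∀ β : A ≃⋆ₐ[ℂ] A, dist (β y) (β (x k)) < ε / 3 := fun β => by
    rwa [dist_eq_norm, ← map_sub, norm_starAlgEquiv, ← dist_eq_norm]
  filter_upwards [Metric.tendsto_nhds.1 ((hk k).tendsto α) (ε / 3) (by positivity)] with β hβ
  have h4 := h3 α
  rw [dist_comm] at h4
  have := dist_triangle4 (β y) (β (x k)) (α (x k)) (α y)
  linarith [h3 β]

theorem secondCountableTopology_aut [TopologicalSpace.SeparableSpace A] :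
    SecondCountableTopology (A ≃⋆ₐ[ℂ] A) := by
  have : SecondCountableTopology A := UniformSpace.secondCountable_of_separable A
  exact (isInducing_aut_denseRange (TopologicalSpace.denseRange_denseSeq A)).secondCountableTopology

/-- The unitary part of an invertible intertwiner implements the same automorphism. -/
theorem exists_unitary_of_isUnit {v : A} (hv : IsUnit v) {α : A ≃⋆ₐ[ℂ] A}
    (h : ∀ x, v * x = α x * v) : ∃ u : unitary A, α = Unitary.conjStarAlgAut ℂ A u := by
  set b := star v * v with hb
  have hbu : IsUnit b := hv.star.mul hv
  have hcomm : ∀ x, Commute b x := by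
    intro x
    have h1 := congrArg star (h (star x))
    simp only [star_mul, star_star, map_star] at h1
    calc b * x = star v * (v * x) := by rw [hb, mul_assoc]
      _ = star v * α x * v := by rw [h, mul_assoc]
      _ = x * star v * v := by rw [← h1]
      _ = x * b := by rw [hb, mul_assoc]
  have hpos : ∀ r ∈ spectrum ℝ b, 0 < r := by
    intro r hr
    refine lt_of_le_of_ne (spectrum_star_mul_self_nonneg r hr) fun h0 => ?_
    subst h0
    exact spectrum.zero_notMem ℝ hbu hr
  have hcont : ContinuousOn (fun r : ℝ => (Real.sqrt r)⁻¹) (spectrum ℝ b) :=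
    (Real.continuous_sqrt.continuousOn).inv₀ fun r hr => (Real.sqrt_pos.2 (hpos r hr)).ne'
  set p := cfc (fun r : ℝ => (Real.sqrt r)⁻¹) b with hp
  have hpsa : IsSelfAdjoint p := cfc_predicate _ b
  have hpc : ∀ x, Commute p x := fun x => (hcomm x).cfc_real _
  have hpbp : p * b * p = 1 := by
    have e : p * b = cfc (fun r : ℝ => (Real.sqrt r)⁻¹ * r) b := by
      rw [cfc_mul (fun r : ℝ => (Real.sqrt r)⁻¹) (fun r => r) b hcont continuousOn_id,
        cfc_id' ℝ b]
    have hcont' : ContinuousOn (fun r : ℝ => (Real.sqrt r)⁻¹ * r) (spectrum ℝ b) :=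
      hcont.mul continuousOn_id
    rw [e, hp, ← cfc_mul _ _ b hcont' hcont, ← cfc_one ℝ b]
    refine cfc_congr fun r hr => ?_
    have hs := Real.sqrt_pos.2 (hpos r hr)
    have hs2 := Real.mul_self_sqrt (hpos r hr).le
    simp only [Pi.one_apply]
    field_simp
    nlinarith
  have hpu : IsUnit p := by
    have h1 : p * (b * p) = 1 := by rw [← mul_assoc, hpbp]
    exact ⟨⟨p, b * p, h1, by rw [← (hpc (b * p)).eq]; exact h1⟩, rfl⟩
  have hU : v * p ∈ unitary A := by
    have h1 : star (v * p) * (v * p) = 1 := by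
      rw [star_mul, hpsa.star_eq, ← hpbp, hb]
      simp only [mul_assoc]
    refine Unitary.mem_iff.2 ⟨h1, ?_⟩
    obtain ⟨w, hw⟩ := hv.mul hpu
    rw [← hw] at h1 ⊢
    rw [left_inv_eq_right_inv h1 (Units.mul_inv w), Units.mul_inv]
  refine ⟨⟨v * p, hU⟩, ?_⟩
  ext x
  rw [Unitary.conjStarAlgAut_apply]
  have h1 : v * p * x = α x * (v * p) := by
    rw [mul_assoc, (hpc x).eq, ← mul_assoc, h, mul_assoc]
  change α x = v * p * x * star (v * p)
  rw [h1, mul_assoc, Unitary.mul_star_self_of_mem hU, mul_one]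

/-- If all central sequences are trivial, then the group of inner automorphisms is closed. -/
theorem isClosed_inner [TopologicalSpace.SeparableSpace A] (h : HasContinuousTrace A) :
    IsClosed {α : A ≃⋆ₐ[ℂ] A | ∃ u : unitary A, α = Unitary.conjStarAlgAut ℂ A u} := by
  have := secondCountableTopology_aut (A := A)
  refine IsSeqClosed.isClosed fun α β hα hβ => ?_
  choose u hu using hα
  have hconv : ∀ y, Tendsto (fun n => (u n : A) * y * star (u n : A)) atTop (𝓝 (β y)) := by
    intro y
    refine (((continuous_aut_eval y).tendsto β).comp hβ).congr fun n => ?_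
    simp [hu n]
  have hnear : ∀ ε > 0, ∃ N, ∀ i ≥ N, ∀ j ≥ N, ∃ z ∈ Subalgebra.center ℂ A,
      ‖((star (u i) * u j : unitary A) : A) - z‖ < ε := by
    by_contra! hcon
    obtain ⟨ε, hε, hcon⟩ := hcon
    choose i hi j hj hfar using hcon
    have hc : IsCentralSequence fun N => ((star (u (i N)) * u (j N) : unitary A) : A) := by
      refine ⟨⟨‖(1 : A)‖, fun N => ?_⟩, fun b => ?_⟩
      · rw [← CStarRing.norm_coe_unitary_mul (star (u (i N)) * u (j N)) (1 : A), mul_one]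
      · have hi' : Tendsto i atTop atTop := tendsto_atTop_mono hi tendsto_id
        have hj' : Tendsto j atTop atTop := tendsto_atTop_mono hj tendsto_id
        have h0 := ((hconv b).comp hj').sub ((hconv b).comp hi')
        rw [sub_self] at h0
        rw [tendsto_zero_iff_norm_tendsto_zero] at h0 ⊢
        refine h0.congr fun N => ?_
        have e : ((star (u (i N)) * u (j N) : unitary A) : A) * b -
            b * ((star (u (i N)) * u (j N) : unitary A) : A) =
            ((star (u (i N)) : unitary A) : A) * ((u (j N) : A) * b * star (u (j N) : A) -
              (u (i N) : A) * b * star (u (i N) : A)) * (u (j N) : A) := by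
          have h1 : star (u (j N) : A) * (u (j N) : A) = 1 :=
            Unitary.star_mul_self_of_mem (u (j N)).2
          have h2 : star (u (i N) : A) * (u (i N) : A) = 1 :=
            Unitary.star_mul_self_of_mem (u (i N)).2
          simp only [Submonoid.coe_mul, Unitary.coe_star, mul_sub, sub_mul, mul_assoc, h1, mul_one]
          rw [← mul_assoc (star (u (i N) : A)) (u (i N) : A), h2, one_mul]
        rw [e, CStarRing.norm_mul_coe_unitary, CStarRing.norm_coe_unitary_mul]
        rfl
    obtain ⟨z, hz, hlim⟩ := h _ hc
    obtain ⟨N, hN⟩ := (hlim.eventually_lt_const hε).exists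
    exact absurd hN (not_lt.2 (hfar N (z N) (hz N)))
  choose N hN using fun k : ℕ => hnear ((1 / 2) ^ (k + 3)) (by positivity)
  let n : ℕ → ℕ := fun k => k + (Finset.range (k + 1)).sup N
  have hn : ∀ k, N k ≤ n k := fun k =>
    le_add_left (Finset.le_sup (f := N) (by simp))
  have hn' : ∀ k, N k ≤ n (k + 1) := fun k =>
    le_add_left (Finset.le_sup (f := N) (by simp))
  choose z hz hzd using fun k => hN k (n (k + 1)) (hn' k) (n k) (hn k)
  let c : ℕ → A := fun k => Nat.rec 1 (fun k c => z k * c) k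
  have hc : ∀ k, c k ∈ Subalgebra.center ℂ A := by
    intro k
    induction k with
    | zero => exact one_mem _
    | succ k ih => exact mul_mem (hz k) ih
  let v : ℕ → A := fun k => (u (n k) : A) * c k
  have hstep : ∀ k, ‖v (k + 1) - v k‖ ≤ (1 / 2) ^ (k + 3) * ‖v k‖ := by
    intro k
    have e : v (k + 1) - v k = (u (n (k + 1)) : A) *
        ((z k - ((star (u (n (k + 1))) * u (n k) : unitary A) : A)) * c k) := by
      have h1 : (u (n (k + 1)) : A) * star (u (n (k + 1)) : A) = 1 :=
        Unitary.mul_star_self_of_mem (u (n (k + 1))).2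
      simp only [v, Submonoid.coe_mul, Unitary.coe_star, mul_sub, sub_mul, mul_assoc]
      rw [← mul_assoc (u (n (k + 1)) : A) (star _), h1, one_mul]
    rw [e, CStarRing.norm_coe_unitary_mul, CStarRing.norm_coe_unitary_mul]
    refine (norm_mul_le _ _).trans ?_
    rw [norm_sub_rev]
    gcongr
    exact (hzd k).le
  have hone : ‖(1 : A)‖ ≤ 1 := by
    rcases subsingleton_or_nontrivial A with hA | hA
    · rw [Subsingleton.elim (1 : A) 0]; simp
    · exact CStarRing.norm_one.le
  have hv0 : ‖v 0‖ ≤ 1 := by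
    simp only [v, CStarRing.norm_coe_unitary_mul]
    exact hone
  have hbound : ∀ k, ‖v k - v 0‖ ≤ 1 / 2 - (1 / 2) ^ (k + 1) := by
    intro k
    induction k with
    | zero => simp
    | succ k ih =>
      have h1 : ‖v k‖ ≤ 2 := by
        have e : v k = (v k - v 0) + v 0 := by abel
        rw [e]
        have : (0 : ℝ) ≤ (1 / 2) ^ (k + 1) := by positivity
        linarith [norm_add_le (v k - v 0) (v 0)]
      have h2 := (hstep k).trans (mul_le_mul_of_nonneg_left h1 (by positivity))
      have e : v (k + 1) - v 0 = (v (k + 1) - v k) + (v k - v 0) := by abel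
      rw [e]
      refine (norm_add_le _ _).trans ?_
      simp only [pow_add] at h2 ih ⊢
      linarith
  have hcauchy : CauchySeq v := by
    refine cauchySeq_of_norm_sub_le (k := 0) fun k _ => (hstep k).trans ?_
    have h1 : ‖v k‖ ≤ 2 := by
      have e : v k = (v k - v 0) + v 0 := by abel
      rw [e]
      have : (0 : ℝ) ≤ (1 / 2) ^ (k + 1) := by positivity
      linarith [norm_add_le (v k - v 0) (v 0), hbound k]
    have h2 := mul_le_mul_of_nonneg_left h1 (show (0 : ℝ) ≤ (1 / 2) ^ (k + 3) by positivity)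
    refine h2.trans ?_
    rw [pow_add]
    have : (0 : ℝ) ≤ (1 / 2) ^ k := by positivity
    linarith
  obtain ⟨w, hw⟩ := cauchySeq_tendsto_of_complete hcauchy
  have hw0 : ‖w - v 0‖ ≤ 1 / 2 := by
    refine le_of_tendsto (hw.sub_const (v 0)).norm (Eventually.of_forall fun k => ?_)
    refine (hbound k).trans ?_
    have : (0 : ℝ) ≤ (1 / 2) ^ (k + 1) := by positivity
    linarith
  have hwu : IsUnit w := by
    have hv0u : v 0 = (u (n 0) : A) := mul_one _
    have h1 : IsUnit (1 - ((star (u (n 0)) : unitary A) : A) * (v 0 - w)) := by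
      refine isUnit_one_sub_of_norm_lt_one ?_
      rw [CStarRing.norm_coe_unitary_mul, norm_sub_rev]
      linarith
    have h2 : star (u (n 0) : A) * (u (n 0) : A) = 1 :=
      Unitary.star_mul_self_of_mem (u (n 0)).2
    have h3 : (u (n 0) : A) * star (u (n 0) : A) = 1 :=
      Unitary.mul_star_self_of_mem (u (n 0)).2
    have e : w = (u (n 0) : A) * (1 - ((star (u (n 0)) : unitary A) : A) * (v 0 - w)) := by
      rw [mul_sub, mul_one, ← mul_assoc, Unitary.coe_star, h3, one_mul, hv0u]
      abel
    rw [e]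
    exact IsUnit.mul ⟨⟨_, _, h3, h2⟩, rfl⟩ h1
  refine exists_unitary_of_isUnit hwu fun x => ?_
  have hnt : Tendsto n atTop atTop :=
    tendsto_atTop_mono (fun k => Nat.le_add_right _ _) tendsto_id
  refine tendsto_nhds_unique (hw.mul_const x) ((((hconv x).comp hnt).mul hw).congr fun k => ?_)
  have h2 : star (u (n k) : A) * (u (n k) : A) = 1 :=
    Unitary.star_mul_self_of_mem (u (n k)).2
  simp only [Function.comp_apply, v, mul_assoc]
  rw [← mul_assoc (star (u (n k) : A)), h2, one_mul, ← (Subalgebra.mem_center_iff.1 (hc k) x)]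

/-- If all central sequences are trivial, then unitary equivalence of automorphisms is smooth. -/
theorem isSmooth_of_hasContinuousTrace [TopologicalSpace.SeparableSpace A]
    (h : HasContinuousTrace A) : IsSmooth (unitaryEquivalence A) := by
  have := secondCountableTopology_aut (A := A)
  let B := TopologicalSpace.countableBasis (A ≃⋆ₐ[ℂ] A)
  have hB := TopologicalSpace.isBasis_countableBasis (A ≃⋆ₐ[ℂ] A)
  have hBc : Countable B := (TopologicalSpace.countable_countableBasis _).to_subtype
  obtain ⟨e, he⟩ := MeasureTheory.exists_measurableEmbedding_real (B → Prop)
  let F : (A ≃⋆ₐ[ℂ] A) → B → Prop := fun α V => ∃ β ∈ V.1, unitaryEquivalence A β α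
  have hF : Measurable F := by
    refine measurable_pi_iff.2 fun V => measurableSet_setOfPred.1 (IsOpen.measurableSet ?_)
    have hV : {α | F α V} =
        ⋃ u : unitary A, (fun α => Unitary.conjStarAlgAut ℂ A u * α) ⁻¹' V.1 := by
      ext α
      simp only [F, Set.mem_ofPred_eq, Set.mem_iUnion, Set.mem_preimage]
      constructor
      · rintro ⟨β, hβ, u, rfl⟩
        exact ⟨u, hβ⟩
      · rintro ⟨u, hu⟩
        exact ⟨_, hu, u, rfl⟩
    rw [hV]
    refine isOpen_iUnion fun u => (hB.isOpen V.2).preimage (continuous_aut_iff.2 fun y => ?_)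
    simp only [StarAlgEquiv.mul_apply, Unitary.conjStarAlgAut_apply]
    exact ((continuous_const.mul (continuous_aut_eval y)).mul continuous_const)
  refine ⟨e ∘ F, he.measurable.comp hF, fun α α' => ?_⟩
  change e (F α) = e (F α') ↔ unitaryEquivalence A α α'
  rw [he.injective.eq_iff]
  constructor
  · intro hFF
    by_contra hne
    have hcl : IsClosed {β | unitaryEquivalence A β α'} := by
      have hc : Continuous fun β : A ≃⋆ₐ[ℂ] A => β * α'⁻¹ :=
        continuous_aut_iff.2 fun y => continuous_aut_eval (α'⁻¹ y)
      convert (isClosed_inner h).preimage hc using 1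
      ext β
      simp only [Set.mem_ofPred_eq, Set.mem_preimage, mul_inv_eq_iff_eq_mul]
      rfl
    obtain ⟨V, hV, hαV, hsub⟩ := hB.exists_subset_of_mem_open
      (show α ∈ {β | unitaryEquivalence A β α'}ᶜ from hne) hcl.isOpen_compl
    have h1 : F α ⟨V, hV⟩ := ⟨α, hαV, (unitaryEquivalence A).refl α⟩
    rw [hFF] at h1
    obtain ⟨β, hβV, hβ⟩ := h1
    exact hsub hβV hβ
  · intro hαα'
    funext V
    exact propext ⟨fun ⟨β, hβ, hβα⟩ => ⟨β, hβ, (unitaryEquivalence A).trans hβα hαα'⟩,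
      fun ⟨β, hβ, hβα⟩ => ⟨β, hβ, (unitaryEquivalence A).trans hβα
        ((unitaryEquivalence A).symm hαα')⟩⟩

end Smooth

end NonclassificationUE

theorem theorem5p1 (A : Type*) [CStarAlgebra A] [TopologicalSpace.SeparableSpace A] :
    (¬ NonclassificationUE.HasContinuousTrace A →
      ¬ NonclassificationUE.ClassifiableByCountableStructures
          (NonclassificationUE.unitaryEquivalence A)) ∧
    (NonclassificationUE.IsSmooth (NonclassificationUE.unitaryEquivalence A) ∨
      ¬ NonclassificationUE.ClassifiableByCountableStructures
          (NonclassificationUE.unitaryEquivalence A)) := by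
  by_cases h : NonclassificationUE.HasContinuousTrace A
  · exact ⟨fun h' => absurd h h', Or.inl (NonclassificationUE.isSmooth_of_hasContinuousTrace h)⟩
  · have := NonclassificationUE.not_classifiable_of_not_hasContinuousTrace h
    exact ⟨fun _ => this, Or.inr this⟩
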